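/- Let $H$ be a real Hilbert space and let $L:\mathscr D(L)\subset H\to H$ be densely defined, self-adjoint, positive definite, with compact inverse. Let $\{e_j\}_{j\in\mathbb N}$ be an orthonormal basis of $H$ of eigenvectors of $L$ with eigenvalues $0<\lambda_1\le\lambda_2\le\dots$, and assume $c_\lambda j^\alpha\le\lambda_j\le C_\lambda j^\alpha$ for all $j$, with constants $c_\lambda,C_\lambda>0$. For $\gamma\ge 0$ let $\dot H^{2\gamma}=\mathscr D(L^\gamma)=\{\psi\in H:\sum_j\lambda_j^{2\gamma}(\psi,e_j)_H^2<\infty\}$ with norm $\|L^\gamma\psi\|_H$, where $L^\gamma\psi=\sum_j\lambda_j^\gamma(\psi,e_j)_He_j$; let $\dot H^{-2\gamma}$ be its dual, and extend $L^\gamma$ to $H\to\dot H^{-2\gamma}$ by continuity. Let $\beta\in(0,1)$, let $\xi_1,\xi_2,\dots$ be independent standard normal random variables on a probability space $\Omega$, let $\mathcal W=\sum_j\xi_je_j$ be white noise (convergence in $L_2(\Omega;\dot H^{-2\beta})$), and for $g\in H$ let $u$ be the $H$-valued random variable solving $L^\beta u=g+\mathcal W$ almost surely. For $h\in(0,1)$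 let $V_h\subset\dot H^1$ be a finite-dimensional subspace, $N_h=\dim V_h$, let $\Pi_h:H\to V_h$ be the $H$-orthogonal projection and $L_h:V_h\to V_h$ the Galerkin operator, $(L_h\psi,\phi)_H=\langle L\psi,\phi\rangle$ for $\psi,\phi\in V_h$. Let $\{e_{j,h}\}_{j=1}^{N_h}$ be an $H$-orthonormal basis of $V_h$ of eigenvectors of $L_h$ with eigenvalues $\lambda_{1,h}\le\dots\le\lambda_{N_h,h}$. Assume that 1. there are $d\in\mathbb N$, $d\ge1$, and constants $c,c'>0$ with $c\,h^{-d}\le N_h\le c'h^{-d}$ for all $h\in(0,1)$; 2. there are $C_1,C_2>0$, $h_0\in(0,1)$, $r,s>0$, $q>1$ such that $\lambda_j\le\lambda_{j,h}\le\lambda_j+C_1h^r\lambda_j^q$ and $\|e_j-e_{j,h}\|_H^2\le C_2h^{2s}\lambda_j^q$ for all $h\in(0,h_0)$ and $1\le j\le N_h$; 3. $\frac1{2\beta}<\alpha\le\min\left\{\frac r{(q-1)d},\frac{2s}{qd}\right\}$. For a basis $\Phi=\{\phi_{j,h}\}_{j=1}^{N_h}$ of $V_h$ set $R_{ij}=(e_{i,h},\phi_{j,h})_H$,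 $\widetilde\xi=R^{-1}(\xi_1,\dots,\xi_{N_h})^T$, $\mathcal W_h^\Phi=\sum_{j}\widetilde\xi_j\phi_{j,h}$. For $k>0$ let $$u^Q_{h,k}=Q^\beta_{h,k}(\Pi_hg+\mathcal W_h^\Phi),\qquad Q^\beta_{h,k}=\frac{2k\sin(\pi\beta)}{\pi}\sum_{\ell=-K^-}^{K^+}e^{2\beta\ell k}(I+e^{2\ell k}L_h)^{-1},$$ with $K^-=\lceil\pi^2/(4\beta k^2)\rceil$ and $K^+=\lceil\pi^2/(4(1-\beta)k^2)\rceil$. Then for every $k_0>0$ there is a constant $C>0$, independent of $h\in(0,h_0)$, $k\in(0,k_0)$, $g\in H$ and $\Phi$, such that $u,u^Q_{h,k}\in L_2(\Omega;H)$ and $$\begin{aligned}\bigl|\|u\|_{L_2(\Omega;H)}^2-\|u^Q_{h,k}\|_{L_2(\Omega;H)}^2\bigr|\le{}& C\bigl(h^{\min\{d(2\alpha\beta-1),r,s\}}+e^{-\pi^2/(2k)}\bigr)\|g\|_H^2\\&+C\bigl(h^{\min\{d(2\alpha\beta-1),r\}}\,\ell(h)+e^{-\pi^2/k}h^{-d}+e^{-\pi^2/(2k)}+e^{-\pi^2/(2k)}f_{\alpha,\beta}(h)\bigr).\end{aligned}$$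 Here $f_{\alpha,\beta}(h)=h^{d(\alpha\beta-1)}$ if $\alpha\beta\ne1$ and $f_{\alpha,\beta}(h)=|\ln h|$ if $\alpha\beta=1$; and $\ell(h)=1$, except in the critical case $d(2\alpha\beta-1)=\alpha d(q-1)=r$, in which $\ell(h)=|\ln h|$. -/

import Mathlib

open MeasureTheory ProbabilityTheory Filter Topology

noncomputable section

/-- Standing assumptions on the unbounded operator `L` on the real Hilbert space `H`:
densely defined, self-adjoint, positive definite, with a compact inverse. -/
structure IsEllipticOperator {H : Type*} [NormedAddCommGroup H] [InnerProductSpace ℝ H]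
    [CompleteSpace H] (L : H →ₗ.[ℝ] H) : Prop where
  dense : Dense (L.domain : Set H)
  selfAdjoint : IsSelfAdjoint L
  posDef : ∀ x : L.domain, x ≠ 0 → 0 < inner ℝ (L x) (x : H)
  compactInverse : ∃ T : H →L[ℝ] H, IsCompactOperator T ∧
    (∀ x : L.domain, T (L x) = x) ∧ ∀ y : H, ∃ hy : T y ∈ L.domain, L ⟨T y, hy⟩ = y

/-- An orthonormal basis of `H` of eigenvectors of `L`, with the positive eigenvalues in
nondecreasing order.  The index `j : ℕ` starts at `0`, so `basis j` is `e_{j+1}` and `eig j` is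
`λ_{j+1}` in the usual numbering. -/
structure OrderedEigenbasis {H : Type*} [NormedAddCommGroup H] [InnerProductSpace ℝ H]
    [CompleteSpace H] (L : H →ₗ.[ℝ] H) where
  basis : HilbertBasis ℕ ℝ H
  eig : ℕ → ℝ
  eig_pos : ∀ j, 0 < eig j
  eig_mono : Monotone eig
  basis_mem : ∀ j, basis j ∈ L.domain
  map_basis : ∀ j, L ⟨basis j, basis_mem j⟩ = eig j • basis j

namespace OrderedEigenbasis

variable {H : Type*} [NormedAddCommGroup H] [InnerProductSpace ℝ H] [CompleteSpace H]
  {L : H →ₗ.[ℝ] H} (S : OrderedEigenbasis L)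

/-- A square summable real sequence as an element of `ℓ²`. -/
theorem memlp_of_summable {f : ℕ → ℝ} (hf : Summable fun j => f j ^ 2) : Memℓp f 2 :=
  memℓp_gen (by simpa using hf)

theorem summable_sq_of_memlp {f : ℕ → ℝ} (hf : Memℓp f 2) : Summable fun j => f j ^ 2 := by
  have h := (memℓp_gen_iff (p := 2) (by simp)).1 hf
  simpa using h

/-- The domain of the fractional power `L ^ γ`: all `ψ` with `∑ λ_j ^ (2γ) ⟨ψ, e_j⟩ ^ 2 < ∞`. -/
def powDomain (γ : ℝ) : Submodule ℝ H where
  carrier := {ψ | Summable fun j => (S.eig j ^ γ * inner ℝ (S.basis j) ψ) ^ 2}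
  zero_mem' := by simp [summable_zero]
  add_mem' := by
    intro a b ha hb
    have h := (memlp_of_summable ha).add (memlp_of_summable hb)
    refine (summable_sq_of_memlp h).congr fun j => ?_
    simp [inner_add_right, mul_add]
  smul_mem' := by
    intro c a ha
    have h := Summable.mul_left (c ^ 2) (show Summable _ from ha)
    refine h.congr fun j => ?_
    simp only [inner_smul_right]
    ring

theorem mem_powDomain {γ : ℝ} {ψ : H} :
    ψ ∈ S.powDomain γ ↔ Summable fun j => (S.eig j ^ γ * inner ℝ (S.basis j) ψ) ^ 2 := Iff.rfl

/-- The fractional power `L ^ γ ψ = ∑ λ_j ^ γ ⟨ψ, e_j⟩ e_j`, as the vector of `H` with these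
coefficients in the basis `e_j`. -/
def pow (γ : ℝ) : S.powDomain γ →ₗ[ℝ] H where
  toFun ψ := S.basis.repr.symm
    ⟨fun j => S.eig j ^ γ * inner ℝ (S.basis j) (ψ : H), memlp_of_summable ψ.2⟩
  map_add' a b := by
    rw [← map_add]
    congr 1
    ext j
    rw [lp.coeFn_add]
    simp only [Pi.add_apply, Submodule.coe_add, inner_add_right, mul_add]
  map_smul' c a := by
    rw [RingHom.id_apply, ← map_smul]
    congr 1
    ext j
    simp [inner_smul_right, mul_left_comm]

theorem hasSum_pow (γ : ℝ) (ψ : S.powDomain γ) :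
    HasSum (fun j => (S.eig j ^ γ * inner ℝ (S.basis j) (ψ : H)) • S.basis j) (S.pow γ ψ) :=
  S.basis.hasSum_repr_symm _

theorem inner_basis_pow (γ : ℝ) (ψ : S.powDomain γ) (j : ℕ) :
    inner ℝ (S.basis j) (S.pow γ ψ) = S.eig j ^ γ * inner ℝ (S.basis j) (ψ : H) := by
  rw [← S.basis.repr_apply_apply]
  simp [pow]

/-- For `γ ≥ 0` the norm of `H` is controlled by the norm of `L ^ γ ψ`. -/
theorem norm_le_pow {γ : ℝ} (hγ : 0 ≤ γ) (ψ : S.powDomain γ) :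
    ‖(ψ : H)‖ ≤ (S.eig 0 ^ γ)⁻¹ * ‖S.pow γ ψ‖ := by
  have h0 : 0 < S.eig 0 ^ γ := Real.rpow_pos_of_pos (S.eig_pos 0) γ
  rw [← div_eq_inv_mul, le_div_iff₀ h0, mul_comm]
  have h1 : S.eig 0 ^ γ * ‖(ψ : H)‖ = ‖S.eig 0 ^ γ • (ψ : H)‖ := by
    rw [norm_smul, Real.norm_of_nonneg h0.le]
  rw [h1, ← S.basis.repr.norm_map, ← S.basis.repr.norm_map (S.pow γ ψ)]
  refine lp.norm_mono (by simp) fun j => ?_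
  rw [S.basis.repr_apply_apply, S.basis.repr_apply_apply, inner_basis_pow, inner_smul_right,
    norm_mul, norm_mul]
  have h2 : S.eig 0 ^ γ ≤ S.eig j ^ γ :=
    Real.rpow_le_rpow (S.eig_pos 0).le (S.eig_mono (Nat.zero_le j)) hγ
  gcongr
  rw [Real.norm_of_nonneg h0.le, Real.norm_of_nonneg (h0.le.trans h2)]
  exact h2

theorem pow_injective (γ : ℝ) : Function.Injective (S.pow γ) := by
  intro a b hab
  apply Subtype.ext
  apply S.basis.repr.injective
  ext j
  have h : inner ℝ (S.basis j) (S.pow γ a) = inner ℝ (S.basis j) (S.pow γ b) := by rw [hab]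
  rw [inner_basis_pow, inner_basis_pow] at h
  rw [S.basis.repr_apply_apply, S.basis.repr_apply_apply]
  exact mul_left_cancel₀ (Real.rpow_pos_of_pos (S.eig_pos j) γ).ne' h

/-- The Hilbert space `Ḣ^{2γ}`: the domain of `L ^ γ` with the norm `‖L ^ γ ψ‖`. -/
def HDot (γ : ℝ) : Type _ := S.powDomain γ

instance (γ : ℝ) : AddCommGroup (S.HDot γ) := inferInstanceAs (AddCommGroup (S.powDomain γ))

instance (γ : ℝ) : Module ℝ (S.HDot γ) := inferInstanceAs (Module ℝ (S.powDomain γ))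

/-- `L ^ γ` as a linear map on `Ḣ^{2γ}`. -/
def powLin (γ : ℝ) : S.HDot γ →ₗ[ℝ] H := S.pow γ

/-- The linear inclusion of `Ḣ^{2γ}` into `H`. -/
def inclLin (γ : ℝ) : S.HDot γ →ₗ[ℝ] H := (S.powDomain γ).subtype

instance (γ : ℝ) : NormedAddCommGroup (S.HDot γ) :=
  NormedAddCommGroup.induced (S.HDot γ) H (S.powLin γ) (S.pow_injective γ)

instance (γ : ℝ) : NormedSpace ℝ (S.HDot γ) :=
  NormedSpace.induced ℝ (S.HDot γ) H (S.powLin γ)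

theorem norm_hDot (γ : ℝ) (ψ : S.HDot γ) : ‖ψ‖ = ‖S.powLin γ ψ‖ := rfl

/-- The dual space `Ḣ^{-2γ}` with its operator norm. -/
abbrev HDotDual (γ : ℝ) : Type _ := StrongDual ℝ (S.HDot γ)

/-- The isometry `L ^ γ : Ḣ^{2γ} → H`. -/
def powCLM (γ : ℝ) : S.HDot γ →L[ℝ] H :=
  (S.powLin γ).mkContinuous 1 fun ψ => by rw [one_mul, norm_hDot]

/-- The embedding `Ḣ^{2γ} ↪ H`, for `γ ≥ 0`. -/
def incl (γ : ℝ) (hγ : 0 ≤ γ) : S.HDot γ →L[ℝ] H :=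
  (S.inclLin γ).mkContinuous (S.eig 0 ^ γ)⁻¹ fun ψ => S.norm_le_pow hγ ψ

/-- The embedding `H ↪ Ḣ^{-2γ}`, `x ↦ ⟨x, ·⟩_H`, for `γ ≥ 0`. -/
def toDual (γ : ℝ) (hγ : 0 ≤ γ) (x : H) : S.HDotDual γ := (innerSL ℝ x).comp (S.incl γ hγ)

/-- The continuous extension `L ^ γ : H → Ḣ^{-2γ}` of the fractional power: the functional
`L ^ γ x` is `φ ↦ ⟨x, L ^ γ φ⟩_H`. -/
def powExt (γ : ℝ) (x : H) : S.HDotDual γ := (innerSL ℝ x).comp (S.powCLM γ)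

/-- On the domain of `L ^ γ`, the extension agrees with `L ^ γ` itself. -/
theorem powExt_of_mem (γ : ℝ) (hγ : 0 ≤ γ) (ψ : S.powDomain γ) :
    S.powExt γ (ψ : H) = S.toDual γ hγ (S.pow γ ψ) := by
  ext φ'
  suffices h : ∀ φ : S.powDomain γ, inner ℝ (ψ : H) (S.pow γ φ) = inner ℝ (S.pow γ ψ) (φ : H) from
    h φ'
  intro φ
  rw [← S.basis.tsum_inner_mul_inner, ← S.basis.tsum_inner_mul_inner]
  refine tsum_congr fun j => ?_
  rw [inner_basis_pow, real_inner_comm (S.basis j) (S.pow γ ψ), inner_basis_pow,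
    real_inner_comm (S.basis j) (ψ : H)]
  ring

section Noise

variable {Ω : Type*} [MeasurableSpace Ω]

/-- The truncated white noise `W_N = ∑_{j ≤ N} ξ_j e_j`. -/
def truncNoise (ξ : ℕ → Ω → ℝ) (N : ℕ) (ω : Ω) : H :=
  ∑ j ∈ Finset.range N, ξ j ω • S.basis j

/-- `W` is the white noise `∑_j ξ_j e_j`, the series converging in `L²(Ω; Ḣ^{-2γ})`. -/
structure IsWhiteNoise (P : Measure Ω) (γ : ℝ) (hγ : 0 ≤ γ) (ξ : ℕ → Ω → ℝ)
    (W : Ω → S.HDotDual γ) : Prop where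
  memLp : MemLp W 2 P
  tendsto : Tendsto
    (fun N => eLpNorm (fun ω => W ω - S.toDual γ hγ (S.truncNoise ξ N ω)) 2 P) atTop (𝓝 0)

/-- The `H`-valued random variable `u` solves `L ^ β u = g + W` almost surely, as an equation
in `Ḣ^{-2β}`. -/
structure IsSolution (P : Measure Ω) (β : ℝ) (hβ : 0 ≤ β) (g : H) (W : Ω → S.HDotDual β)
    (u : Ω → H) : Prop where
  aestronglyMeasurable : AEStronglyMeasurable u P
  eq : ∀ᵐ ω ∂P, S.powExt β (u ω) = S.toDual β hβ g + W ω

end Noise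

section Galerkin

variable (V : Submodule ℝ H) [FiniteDimensional ℝ V]

/-- `L ^ (1/2)` restricted to a finite-dimensional subspace `V` of `Ḣ^1`. -/
def sqrtOn (hV : V ≤ S.powDomain (1 / 2)) : V →L[ℝ] H :=
  LinearMap.toContinuousLinearMap ((S.pow (1 / 2)).comp (Submodule.inclusion hV))

/-- The Galerkin discretization `L_h : V → V` of `L : Ḣ^1 → Ḣ^{-1}`, characterised by
`⟨L_h ψ, φ⟩_H = ⟨L ψ, φ⟩ = ⟨L ^ (1/2) ψ, L ^ (1/2) φ⟩_H`, see `inner_galerkin`. -/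
def galerkin (hV : V ≤ S.powDomain (1 / 2)) : V →ₗ[ℝ] V :=
  haveI : CompleteSpace V := FiniteDimensional.complete ℝ V
  ((ContinuousLinearMap.adjoint (S.sqrtOn V hV)).comp (S.sqrtOn V hV) : V →L[ℝ] V)

theorem inner_galerkin (hV : V ≤ S.powDomain (1 / 2)) (ψ φ : V) :
    inner ℝ (S.galerkin V hV ψ) φ =
      inner ℝ (S.pow (1 / 2) ⟨ψ, hV ψ.2⟩) (S.pow (1 / 2) ⟨φ, hV φ.2⟩) := by
  have : CompleteSpace V := FiniteDimensional.complete ℝ V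
  exact ContinuousLinearMap.adjoint_inner_left (S.sqrtOn V hV) φ (S.sqrtOn V hV ψ)

end Galerkin

end OrderedEigenbasis

section Quadrature

variable {H : Type*} [NormedAddCommGroup H] [InnerProductSpace ℝ H]

/-- The sinc quadrature
`Q = (2 k sin(π β) / π) ∑_{ℓ = -K⁻}^{K⁺} e^{2 β y_ℓ} (I + e^{2 y_ℓ} L_h)⁻¹`, `y_ℓ = ℓ k`, with
`K⁻ = ⌈π² / (4 β k²)⌉` and `K⁺ = ⌈π² / (4 (1 - β) k²)⌉`. -/
def sincQuadrature (β k : ℝ) {V : Submodule ℝ H} (Lh : V →ₗ[ℝ] V) : V →ₗ[ℝ] V :=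
  (2 * k * Real.sin (Real.pi * β) / Real.pi) •
    ∑ l ∈ Finset.Icc (-⌈Real.pi ^ 2 / (4 * β * k ^ 2)⌉) ⌈Real.pi ^ 2 / (4 * (1 - β) * k ^ 2)⌉,
      Real.exp (2 * β * (l * k)) •
        Ring.inverse ((1 : Module.End ℝ V) + Real.exp (2 * (l * k)) • (Lh : Module.End ℝ V))

/-- The noise `∑_j ξ'_j φ_j` on `V` for a basis `φ` of `V`, where `ξ' = R⁻¹ ξ` and
`R_{ij} = ⟨e_{i,h}, φ_j⟩_H`. -/
def discreteNoise {Ω : Type*} {V : Submodule ℝ H} {N : ℕ} (eh : OrthonormalBasis (Fin N) ℝ V)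
    (φ : Module.Basis (Fin N) ℝ V) (ξ : ℕ → Ω → ℝ) (ω : Ω) : V :=
  ∑ j, (Matrix.mulVec (Matrix.of fun i j : Fin N => inner ℝ (eh i) (φ j))⁻¹
    (fun i : Fin N => ξ i ω)) j • φ j

/-- The numerical approximation `u^Q_{h,k} = Q (Π_h g + W^Φ_h)`, where `Π_h` is the
`H`-orthogonal projection onto `V`. -/
def numericalSolution {Ω : Type*} {V : Submodule ℝ H} [FiniteDimensional ℝ V] {N : ℕ}
    (β k : ℝ) (Lh : V →ₗ[ℝ] V) (eh : OrthonormalBasis (Fin N) ℝ V)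
    (φ : Module.Basis (Fin N) ℝ V) (ξ : ℕ → Ω → ℝ) (g : H) (ω : Ω) : H :=
  (sincQuadrature β k Lh (V.orthogonalProjectionOnto g + discreteNoise eh φ ξ ω) : V)

end Quadrature

/-- `f_{α,β}(h)`: equal to `h ^ (d (αβ - 1))` if `αβ ≠ 1` and to `|ln h|` if `αβ = 1`. -/
def weakRateFactor (d : ℕ) (α β h : ℝ) : ℝ :=
  open Classical in if α * β = 1 then |Real.log h| else h ^ ((d : ℝ) * (α * β - 1))

/-- Equal to `|ln h|` in the critical case `d (2αβ - 1) = α d (q - 1) = r`, and to `1`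
otherwise. -/
def criticalFactor (d : ℕ) (α β q r h : ℝ) : ℝ :=
  open Classical in
  if (d : ℝ) * (2 * α * β - 1) = r ∧ α * d * (q - 1) = r then |Real.log h| else 1

end

/-! Both second moments are diagonal. Testing the equation against `e_j` gives `u` the coefficients
`λ_j^(-β) ((g, e_j) + ξ_j)`, so Parseval yields `E‖u‖² = ∑ λ_j^(-2β) ((g, e_j)² + 1)`
(`IsSolution.memLp_and_integral`). On `V_h` the matrix `R⁻¹` undoes the change of basis, so the
noise is `∑ ξ_j e_{j,h}` whatever `Φ` is. The quadrature operator acts on `e_{j,h}` as a scalar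
`Q_j`, and `E‖u^Q‖² = ∑_{j ≤ N_h} Q_j² ((g, e_{j,h})² + 1)`
(`memLp_and_integral_numericalSolution`).

The difference of these deterministic sums splits into the spectral tail, the eigenvalue error, the
eigenvector error and the quadrature error (`abs_spectral_sub_le`). Each is estimated from `λ_j ~
j^α` and `N_h ~ h^(-d)` by power sums (`rpow_mul_sum_rpow_le`). The tail gives `h^(d(2αβ-1))`. The
upper bound on `α` keeps the growth `λ_j^q` of the eigenpair errors from spoiling the rates.

The scalar quadrature error `|x^(-β) - Q(x)|` is `O(e^(-π²/(2k)))` uniformly for `x ≥ λ_1`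
(`exists_abs_rpow_sub_sincScalar_le`). With `t = 2y + ln x`, the quadrature is a truncated
trapezoidal sum for `∫ e^(βt) / (1 + e^t) dt = π / sin(πβ)`. Poisson summation bounds the
discretization error by `O(e^(-π²/k))`, and `K^±` are chosen so that both truncation errors are
`O(e^(-π²/(2k)))`. -/

noncomputable section

/-! ### Scalar sinc quadrature: Poisson summation and truncation. -/

/-- The Fourier--Laplace transform of the logistic function, by substituting the sigmoid function
into Euler's Beta integral. -/
theorem integral_cexp_mul_inv_one_add_exp {z : ℂ} (h0 : 0 < z.re) (h1 : z.re < 1) :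
    ∫ t : ℝ, Complex.exp (z * t) * ((1 + Real.exp t)⁻¹ : ℝ) = Real.pi / Complex.sin (Real.pi * z) := by
  have hB := Complex.Gamma_mul_Gamma_eq_betaIntegral (s := z) (t := 1 - z) h0 (by simpa using h1)
  rw [Complex.Gamma_mul_Gamma_one_sub, add_sub_cancel, Complex.Gamma_one, one_mul] at hB
  rw [hB, Complex.betaIntegral, intervalIntegral.integral_of_le zero_le_one,
    integral_Ioc_eq_integral_Ioo, ← Real.range_sigmoid, ← Set.image_univ,
    integral_image_eq_integral_abs_deriv_smul MeasurableSet.univ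
      (fun x _ => (Real.hasDerivAt_sigmoid x).hasDerivWithinAt) Real.sigmoid_injective.injOn,
    setIntegral_univ]
  refine integral_congr_ae (Eventually.of_forall fun t => ?_)
  have hs := Real.sigmoid_pos t
  have hs' := Real.sigmoid_pos (-t)
  have e1 : (1 : ℂ) - (Real.sigmoid t : ℂ) = (Real.sigmoid (-t) : ℂ) := by
    rw [Real.sigmoid_neg]; push_cast; ring
  have hst : Real.sigmoid t = Real.exp t * Real.sigmoid (-t) := by
    rw [← Real.sigmoid_mul_rexp_neg, mul_left_comm, ← Real.exp_add]; simp
  have hinv : (1 + Real.exp t)⁻¹ = Real.sigmoid (-t) := by simp [Real.sigmoid_def]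
  simp only [← Real.sigmoid_neg, abs_of_pos (mul_pos hs hs'), hinv, e1]
  have c1 : ((Real.sigmoid (-t) : ℝ) : ℂ) ≠ 0 := by exact_mod_cast hs'.ne'
  have c2 : ((Real.sigmoid t : ℝ) : ℂ) ≠ 0 := by exact_mod_cast hs.ne'
  rw [Complex.real_smul, Complex.cpow_sub _ _ c2, Complex.cpow_sub _ _ c1,
    Complex.cpow_sub _ _ c1, Complex.cpow_one, Complex.cpow_one]
  have c3 : ((Real.sigmoid t : ℝ) : ℂ) ^ z = Complex.exp (z * t) * (Real.sigmoid (-t) : ℂ) ^ z := by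
    rw [hst, Complex.ofReal_mul, Complex.mul_cpow_ofReal_nonneg (Real.exp_pos _).le hs'.le,
      Complex.ofReal_exp, Complex.cpow_def_of_ne_zero (Complex.exp_ne_zero _), ← Complex.ofReal_exp,
      ← Complex.ofReal_log (Real.exp_pos t).le, Real.log_exp, mul_comm (t : ℂ)]
  have c4 : ((Real.sigmoid (-t) : ℝ) : ℂ) ^ z ≠ 0 := by simp [Complex.cpow_eq_zero_iff, c1]
  rw [c3]
  push_cast
  field_simp

/-- Reverse triangle inequality for `e^(-iz) - e^(iz)`, whose terms have moduli `e^(Im z)` and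
`e^(-Im z)`. It makes the Fourier transform of the logistic function decay exponentially. -/
theorem abs_sinh_im_le_norm_sin (z : ℂ) : |Real.sinh z.im| ≤ ‖Complex.sin z‖ := by
  have h := abs_norm_sub_norm_le (Complex.exp (-z * Complex.I)) (Complex.exp (z * Complex.I))
  rw [Complex.norm_exp, Complex.norm_exp] at h
  rw [Complex.sin, norm_div, norm_mul, Complex.norm_I, mul_one, Complex.norm_ofNat, Real.sinh_eq,
    abs_div, abs_two]
  simp only [Complex.mul_re, Complex.neg_re, Complex.neg_im, Complex.I_re, Complex.I_im, mul_zero,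
    mul_one, zero_sub, neg_neg] at h
  gcongr

/-- Two-sided geometric domination of a bilateral series away from the index `0`. -/
theorem summable_and_norm_tsum_sub_le_of_geometric {a : ℤ → ℂ} {M ρ : ℝ} (hρ0 : 0 ≤ ρ) (hρ1 : ρ < 1)
    (ha : ∀ n : ℤ, n ≠ 0 → ‖a n‖ ≤ M * ρ ^ n.natAbs) :
    Summable a ∧ ‖∑' n, a n - a 0‖ ≤ 2 * M * ρ / (1 - ρ) := by
  have hg : HasSum (fun n : ℕ => M * ρ ^ (n + 1)) (M * ρ / (1 - ρ)) := by
    have := (hasSum_geometric_of_lt_one hρ0 hρ1).mul_left (M * ρ)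
    simpa only [← div_eq_mul_inv, mul_assoc, ← pow_succ'] using this
  have h1 : ∀ n : ℕ, ‖a (n + 1)‖ ≤ M * ρ ^ (n + 1) := fun n => by
    have := ha (n + 1) (by omega)
    rwa [show ((n : ℤ) + 1).natAbs = n + 1 by omega] at this
  have h2 : ∀ n : ℕ, ‖a (-(n + 1))‖ ≤ M * ρ ^ (n + 1) := fun n => by
    have := ha (-(n + 1)) (by omega)
    rwa [show (-((n : ℤ) + 1)).natAbs = n + 1 by omega] at this
  have s1 : Summable fun n : ℕ => a (n + 1) := .of_norm_bounded hg.summable h1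
  have s2 : Summable fun n : ℕ => a (-(n + 1)) := .of_norm_bounded hg.summable h2
  have hs := HasSum.of_add_one_of_neg_add_one s1.hasSum s2.hasSum
  refine ⟨hs.summable, ?_⟩
  rw [hs.tsum_eq]
  have b1 := tsum_of_norm_bounded hg h1
  have b2 := tsum_of_norm_bounded hg h2
  calc _ = ‖(∑' n : ℕ, a (n + 1)) + ∑' n : ℕ, a (-(n + 1))‖ := by congr 1; ring
    _ ≤ _ := (norm_add_le _ _).trans ((add_le_add b1 b2).trans (by ring_nf; rfl))

/-- The logistic function `exp (β t) / (1 + exp t)` decays exponentially. -/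
theorem exp_mul_inv_one_add_exp_le {β : ℝ} (t : ℝ) :
    Real.exp (β * t) * (1 + Real.exp t)⁻¹ ≤ Real.exp (-(min β (1 - β) * |t|)) := by
  have hp := Real.exp_pos t
  rcases le_total 0 t with ht | ht
  · have : (1 + Real.exp t)⁻¹ ≤ Real.exp (-t) := by
      rw [Real.exp_neg]; exact inv_anti₀ hp (by linarith)
    calc _ ≤ Real.exp (β * t) * Real.exp (-t) := by gcongr
      _ = Real.exp (-((1 - β) * t)) := by rw [← Real.exp_add]; ring_nf
      _ ≤ _ := by rw [abs_of_nonneg ht]; gcongr; exact min_le_right _ _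
  · have : (1 + Real.exp t)⁻¹ ≤ 1 := inv_le_one_of_one_le₀ (by linarith)
    calc _ ≤ Real.exp (β * t) * 1 := by gcongr
      _ = Real.exp (-(β * -t)) := by ring_nf
      _ ≤ _ := by
        rw [abs_of_nonpos ht]; gcongr
        · linarith
        · exact min_le_left _ _

/-- Weakens exponential decay to the power decay under which Poisson summation is applied. -/
theorem exp_neg_le_two_mul_rpow {x : ℝ} (hx : 0 < x) : Real.exp (-x) ≤ 2 * x ^ (-2 : ℝ) := by
  have h := Real.pow_div_factorial_le_exp x hx.le 2
  rw [Real.exp_neg, Real.rpow_neg hx.le, Real.rpow_two]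
  rw [inv_le_comm₀ (Real.exp_pos _) (by positivity)]
  refine le_trans (le_of_eq ?_) h
  simp [Nat.factorial]
  field_simp

/-- For `n ≥ 1`, `e^(-yn) ≤ e^(-y) e^(yn)`, so `sinh (yn)` is at least a fixed multiple of `e^(yn)`.
This is the geometric majorant for the nonzero frequencies. -/
theorem inv_sinh_mul_nat_le {y : ℝ} (hy : 0 < y) {n : ℕ} (hn : n ≠ 0) :
    (Real.sinh (y * n))⁻¹ ≤ 2 / (1 - Real.exp (-y)) * Real.exp (-y) ^ n := by
  have hρ : Real.exp (-y) < 1 := by simpa using hy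
  have hn1 : (1 : ℝ) ≤ n := by exact_mod_cast Nat.one_le_iff_ne_zero.2 hn
  have h1 : Real.exp (-(y * n)) ≤ Real.exp (-y) * Real.exp (y * n) := by
    rw [← Real.exp_add]; gcongr; nlinarith
  have h2 : (1 - Real.exp (-y)) / 2 * Real.exp (y * n) ≤ Real.sinh (y * n) := by
    rw [Real.sinh_eq]; linarith
  have h3 : 0 < (1 - Real.exp (-y)) / 2 := by linarith
  refine (inv_anti₀ (by positivity) h2).trans (le_of_eq ?_)
  rw [mul_inv, inv_div, ← Real.exp_neg, ← Real.exp_nat_mul]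
  ring_nf

theorem isBigO_logistic {β τ : ℝ} (hβ : 0 < β) (hβ1 : β < 1) (hτ : 0 < τ) :
    (fun x : ℝ => ((Real.exp (β * (τ * x)) * (1 + Real.exp (τ * x))⁻¹ : ℝ) : ℂ))
      =O[cocompact ℝ] (|·| ^ (-2 : ℝ)) := by
  set c := min β (1 - β) * τ
  have hc : 0 < c := mul_pos (lt_min hβ (by linarith)) hτ
  refine Asymptotics.IsBigO.of_bound (2 * c ^ (-2 : ℝ)) ?_
  have : ∀ᶠ x : ℝ in cocompact ℝ, x ≠ 0 := by
    simpa using (isCompact_singleton (x := (0 : ℝ))).compl_mem_cocompact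
  filter_upwards [this] with x hx
  have hx' : 0 < |x| := abs_pos.2 hx
  rw [Complex.norm_real, Real.norm_of_nonneg (by positivity), Real.norm_of_nonneg (by positivity)]
  refine (exp_mul_inv_one_add_exp_le _).trans ?_
  rw [abs_mul, abs_of_pos hτ, ← mul_assoc, mul_assoc 2, ← Real.mul_rpow hc.le hx'.le]
  exact exp_neg_le_two_mul_rpow (mul_pos hc hx')

/-- The rescaling `t = τ x` turns the transform into Euler's integral at `z = β - 2πi w / τ`, which
stays in the strip `0 < Re z < 1`. -/
theorem fourier_logistic {β τ : ℝ} (hβ : 0 < β) (hβ1 : β < 1) (hτ : 0 < τ) (w : ℝ) :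
    FourierTransform.fourier
      (fun x : ℝ => ((Real.exp (β * (τ * x)) * (1 + Real.exp (τ * x))⁻¹ : ℝ) : ℂ)) w =
      (τ : ℂ)⁻¹ * (Real.pi / Complex.sin (Real.pi * (β - (2 * Real.pi * w / τ : ℝ) * Complex.I))) := by
  rw [Real.fourier_real_eq_integral_exp_smul, ← integral_cexp_mul_inv_one_add_exp (by simpa) (by simpa)]
  have := Measure.integral_comp_mul_left (fun t : ℝ => Complex.exp
    ((β - (2 * Real.pi * w / τ : ℝ) * Complex.I) * t) * ((1 + Real.exp t)⁻¹ : ℝ)) τ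
  rw [abs_of_pos (inv_pos.2 hτ), Complex.real_smul, Complex.ofReal_inv] at this
  rw [← this]
  congr 1
  ext x
  have hτ' : (τ : ℂ) ≠ 0 := by exact_mod_cast hτ.ne'
  rw [smul_eq_mul, Complex.ofReal_mul (Real.exp _), Complex.ofReal_exp, ← mul_assoc, ← Complex.exp_add]
  congr 2
  push_cast
  field_simp
  ring

/-- The trapezoidal rule for the logistic function `exp (β t) / (1 + exp t)` on the real line
converges exponentially in the inverse step size. -/
theorem summable_and_abs_trapezoid_sub_le {β τ : ℝ} (hβ : 0 < β) (hβ1 : β < 1) (hτ : 0 < τ) (a : ℝ) :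
    Summable (fun l : ℤ => Real.exp (β * (τ * l + a)) * (1 + Real.exp (τ * l + a))⁻¹) ∧
    |τ * ∑' l : ℤ, Real.exp (β * (τ * l + a)) * (1 + Real.exp (τ * l + a))⁻¹ -
        Real.pi / Real.sin (Real.pi * β)| ≤
      4 * Real.pi * Real.exp (-(2 * Real.pi ^ 2 / τ)) /
        (1 - Real.exp (-(2 * Real.pi ^ 2 / τ))) ^ 2 := by
  set y := 2 * Real.pi ^ 2 / τ with hy_def
  have hy : 0 < y := by positivity
  set ρ := Real.exp (-y)
  have hρ0 : 0 < ρ := Real.exp_pos _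
  have hρ1 : ρ < 1 := by simpa [ρ] using hy
  set f := fun x : ℝ => ((Real.exp (β * (τ * x)) * (1 + Real.exp (τ * x))⁻¹ : ℝ) : ℂ) with hf
  have hcont : Continuous f := by
    refine Complex.continuous_ofReal.comp (Continuous.mul (by fun_prop) ?_)
    exact Continuous.inv₀ (by fun_prop) fun x => by positivity
  -- The character carrying the offset `a` has modulus one, so the bound is independent of `a`. This
  -- later gives uniformity in `x = e^a`.
  have hF : ∀ n : ℤ, n ≠ 0 →
      ‖FourierTransform.fourier f n * fourier n ((a / τ : ℝ) : UnitAddCircle)‖ ≤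
        (τ⁻¹ * Real.pi * (2 / (1 - ρ))) * ρ ^ n.natAbs := fun n hn => by
    have hn' : n.natAbs ≠ 0 := by simpa
    rw [norm_mul, fourier_apply, Circle.norm_coe, mul_one, hf, fourier_logistic hβ hβ1 hτ,
      norm_mul, norm_inv, norm_div, Complex.norm_real, Complex.norm_real, Real.norm_of_nonneg hτ.le,
      Real.norm_of_nonneg Real.pi_pos.le, mul_assoc τ⁻¹, mul_assoc τ⁻¹, mul_assoc Real.pi,
      div_eq_mul_inv Real.pi]
    gcongr
    refine le_trans ?_ (inv_sinh_mul_nat_le hy hn')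
    have hsinh := abs_sinh_im_le_norm_sin
      (Real.pi * (β - (2 * Real.pi * (n : ℝ) / τ : ℝ) * Complex.I))
    have him : |Real.sinh (Real.pi * (β - (2 * Real.pi * (n : ℝ) / τ : ℝ) * Complex.I) : ℂ).im| =
        Real.sinh (y * n.natAbs) := by
      have : (Real.pi * (β - (2 * Real.pi * (n : ℝ) / τ : ℝ) * Complex.I) : ℂ).im = -(y * n) := by
        simp only [Complex.mul_im, Complex.sub_im, Complex.ofReal_re, Complex.ofReal_im,
          Complex.I_re, Complex.I_im, hy_def]
        ring
      rw [this, Real.abs_sinh, abs_neg, abs_mul, abs_of_pos hy, Nat.cast_natAbs, Int.cast_abs]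
    rw [him] at hsinh
    refine inv_anti₀ ?_ hsinh
    rw [Real.sinh_pos_iff]
    positivity
  obtain ⟨hsum, hbound⟩ := summable_and_norm_tsum_sub_le_of_geometric hρ0.le hρ1 hF
  have hsumF : Summable fun n : ℤ => FourierTransform.fourier f n := by
    refine .of_norm (hsum.norm.congr fun n => ?_)
    rw [norm_mul, fourier_apply, Circle.norm_coe, mul_one]
  have hO := isBigO_logistic hβ hβ1 hτ
  have hP := Real.tsum_eq_tsum_fourier_of_rpow_decay_of_summable hcont one_lt_two hO hsumF (a / τ)
  rw [← hP] at hbound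
  have hval : ∀ l : ℤ, f (a / τ + l) =
      ((Real.exp (β * (τ * l + a)) * (1 + Real.exp (τ * l + a))⁻¹ : ℝ) : ℂ) := fun l => by
    have : τ * (a / τ + l) = τ * l + a := by field_simp; ring
    simp only [hf, this]
  have h0 : FourierTransform.fourier f ((0 : ℤ) : ℝ) * fourier 0 ((a / τ : ℝ) : UnitAddCircle) =
      ((τ⁻¹ * (Real.pi / Real.sin (Real.pi * β)) : ℝ) : ℂ) := by
    rw [hf, fourier_logistic hβ hβ1 hτ]
    simp
  rw [h0, tsum_congr hval, ← Complex.ofReal_tsum, ← Complex.ofReal_sub, Complex.norm_real] at hbound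
  constructor
  -- The decay lemma bounds sup norms over translates of a compact set; a single point suffices
  -- here.
  · have hs : Summable fun l : ℤ => f (a / τ + l) := by
      let K : TopologicalSpace.Compacts ℝ := ⟨{a / τ}, isCompact_singleton⟩
      have h1 := summable_of_isBigO (Real.summable_abs_int_rpow one_lt_two)
        ((isBigO_norm_restrict_cocompact ⟨_, hcont⟩ two_pos hO K).comp_tendsto
          Int.tendsto_coe_cofinite)
      refine .of_norm_bounded h1 fun l => ?_
      exact ContinuousMap.norm_coe_le_norm
        (((⟨f, hcont⟩ : C(ℝ, ℂ)).comp (ContinuousMap.addRight (l : ℝ))).restrict K)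
        ⟨a / τ, Set.mem_singleton _⟩
    exact Complex.summable_ofReal.1 (hs.congr hval)
  · calc _ = τ * ‖∑' l : ℤ, Real.exp (β * (τ * l + a)) * (1 + Real.exp (τ * l + a))⁻¹ -
          τ⁻¹ * (Real.pi / Real.sin (Real.pi * β))‖ := by
          rw [← Real.norm_of_nonneg hτ.le, ← norm_mul, Real.norm_of_nonneg hτ.le, mul_sub,
            mul_inv_cancel_left₀ hτ.ne', Real.norm_eq_abs]
      _ ≤ τ * (2 * (τ⁻¹ * Real.pi * (2 / (1 - ρ))) * ρ / (1 - ρ)) := by gcongr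
      _ = _ := by
        have : 1 - ρ ≠ 0 := by linarith
        field_simp
        ring

theorem hasSum_exp_tail {x : ℝ} (hx : 0 < x) (K : ℤ) :
    HasSum (fun n : ℕ => Real.exp (-(x * (K + 1 + n)))) (Real.exp (-(x * K)) / (Real.exp x - 1)) := by
  have h1 : Real.exp (-x) < 1 := by simpa using hx
  have h := (hasSum_geometric_of_lt_one (Real.exp_pos (-x)).le h1).mul_left (Real.exp (-(x * (K + 1))))
  have e : Real.exp (-(x * (K + 1))) * (1 - Real.exp (-x))⁻¹ =
      Real.exp (-(x * K)) / (Real.exp x - 1) := by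
    have h2 : Real.exp x - 1 ≠ 0 := by
      have := Real.add_one_lt_exp hx.ne'
      linarith
    have h3 : 1 - Real.exp (-x) ≠ 0 := by linarith
    have h4 : Real.exp (-(x * (K + 1))) * Real.exp x = Real.exp (-(x * K)) := by
      rw [← Real.exp_add]; ring_nf
    have h5 : Real.exp (-x) * Real.exp x = 1 := by rw [← Real.exp_add]; simp
    field_simp
    rw [← h4]
    linear_combination Real.exp (-(x * (K + 1))) * h5
  rw [e] at h
  convert! h using 2 with n
  rw [← Real.exp_nat_mul, ← Real.exp_add]
  ring_nf

/-- Truncation error of a bilateral series with exponentially decaying tails. -/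
theorem tsum_sub_sum_Icc_bounds {g : ℤ → ℝ} (hg : Summable g) (hg0 : ∀ l, 0 ≤ g l) {x y A B : ℝ}
    (hx : 0 < x) (hy : 0 < y) (K M : ℤ) (hK : 0 ≤ K) (hM : 0 ≤ M)
    (hr : ∀ l : ℤ, g l ≤ A * Real.exp (-(x * l))) (hl : ∀ l : ℤ, g l ≤ B * Real.exp (-(y * -l))) :
    0 ≤ ∑' l, g l - ∑ l ∈ Finset.Icc (-M) K, g l ∧
    ∑' l, g l - ∑ l ∈ Finset.Icc (-M) K, g l ≤
      A * (Real.exp (-(x * K)) / (Real.exp x - 1)) + B * (Real.exp (-(y * M)) / (Real.exp y - 1)) := by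
  have i1 : Function.Injective fun n : ℕ => K + 1 + (n : ℤ) := fun a b h => by simpa using h
  have i2 : Function.Injective fun n : ℕ => -(M + 1 + (n : ℤ)) := fun a b h => by simpa using h
  have e1 : ∑' n : ℕ, g (K + 1 + n) = ∑' l, (Set.Ioi K).indicator g l := by
    rw [← i1.tsum_eq]
    · refine tsum_congr fun n => (Set.indicator_of_mem ?_ _).symm
      simp only [Set.mem_Ioi]; omega
    · refine (Set.support_indicator_subset).trans fun l hl => ?_
      rw [Set.mem_Ioi] at hl
      exact ⟨(l - K - 1).toNat, by simp only; omega⟩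
  have e2 : ∑' n : ℕ, g (-(M + 1 + n)) = ∑' l, (Set.Iio (-M)).indicator g l := by
    rw [← i2.tsum_eq]
    · refine tsum_congr fun n => (Set.indicator_of_mem ?_ _).symm
      simp only [Set.mem_Iio]; omega
    · refine (Set.support_indicator_subset).trans fun l hl => ?_
      rw [Set.mem_Iio] at hl
      exact ⟨(-l - M - 1).toNat, by simp only; omega⟩
  have e3 : ∑ l ∈ Finset.Icc (-M) K, g l = ∑' l, (Set.Icc (-M) K).indicator g l := by
    rw [← Finset.coe_Icc, ← tsum_subtype]
    exact (Finset.tsum_subtype _ g).symm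
  have e4 : ∑' l, g l = ∑' l, (Set.Icc (-M) K).indicator g l + ∑' l, (Set.Iio (-M)).indicator g l
      + ∑' l, (Set.Ioi K).indicator g l := by
    rw [← (hg.indicator _).tsum_add (hg.indicator _),
      ← ((hg.indicator _).add (hg.indicator _)).tsum_add (hg.indicator _)]
    refine tsum_congr fun l => ?_
    simp only [Set.indicator_apply, Set.mem_Icc, Set.mem_Iio, Set.mem_Ioi]
    by_cases h1 : l < -M
    · simp [h1, show ¬ (-M ≤ l) by omega, show ¬ K < l by omega]
    · by_cases h2 : K < l
      · simp [h1, h2]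
      · simp [h1, h2, show -M ≤ l by omega, show l ≤ K by omega]
  have b1 : ∑' n : ℕ, g (K + 1 + n) ≤ A * (Real.exp (-(x * K)) / (Real.exp x - 1)) := by
    have h := (hasSum_exp_tail hx K).mul_left A
    rw [← h.tsum_eq]
    refine (hg.comp_injective i1).tsum_le_tsum (fun n => ?_) h.summable
    simpa using hr (K + 1 + n)
  have b2 : ∑' n : ℕ, g (-(M + 1 + n)) ≤ B * (Real.exp (-(y * M)) / (Real.exp y - 1)) := by
    have h := (hasSum_exp_tail hy M).mul_left B
    rw [← h.tsum_eq]
    refine (hg.comp_injective i2).tsum_le_tsum (fun n => ?_) h.summable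
    simpa using hl (-(M + 1 + n))
  have n1 : 0 ≤ ∑' n : ℕ, g (K + 1 + n) := tsum_nonneg fun n => hg0 _
  have n2 : 0 ≤ ∑' n : ℕ, g (-(M + 1 + n)) := tsum_nonneg fun n => hg0 _
  rw [e3, e4, ← e1, ← e2]
  constructor <;> linarith

/-- The scalar sinc quadrature approximating `x ^ (-β)`. -/
def sincScalar (β k x : ℝ) : ℝ :=
  (2 * k * Real.sin (Real.pi * β) / Real.pi) *
    ∑ l ∈ Finset.Icc (-⌈Real.pi ^ 2 / (4 * β * k ^ 2)⌉) ⌈Real.pi ^ 2 / (4 * (1 - β) * k ^ 2)⌉,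
      Real.exp (2 * β * (l * k)) * (1 + Real.exp (2 * (l * k)) * x)⁻¹

/-- The cutoff is the least integer `K` with `2δkK ≥ π² / (2k)`, and `e^(2δk) - 1 ≥ 2δk` absorbs the
step size. It serves both tails, with `δ = 1 - β` on the right and `δ = β` on the left. -/
theorem mul_exp_div_exp_sub_one_le {δ k : ℝ} (hδ : 0 < δ) (hk : 0 < k) :
    2 * k * (Real.exp (-(δ * (2 * k) * ⌈Real.pi ^ 2 / (4 * δ * k ^ 2)⌉)) /
      (Real.exp (δ * (2 * k)) - 1)) ≤ δ⁻¹ * Real.exp (-Real.pi ^ 2 / (2 * k)) := by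
  have h1 : δ * (2 * k) ≤ Real.exp (δ * (2 * k)) - 1 := by
    linarith [Real.add_one_le_exp (δ * (2 * k))]
  have h2 : Real.exp (-(δ * (2 * k) * ⌈Real.pi ^ 2 / (4 * δ * k ^ 2)⌉)) ≤
      Real.exp (-Real.pi ^ 2 / (2 * k)) := by
    gcongr
    have h3 := mul_le_mul_of_nonneg_left (Int.le_ceil (Real.pi ^ 2 / (4 * δ * k ^ 2)))
      (by positivity : 0 ≤ δ * (2 * k))
    have h4 : δ * (2 * k) * (Real.pi ^ 2 / (4 * δ * k ^ 2)) = Real.pi ^ 2 / (2 * k) := by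
      field_simp; norm_num
    rw [h4] at h3
    rw [neg_div]
    exact neg_le_neg h3
  calc _ ≤ 2 * k * (Real.exp (-Real.pi ^ 2 / (2 * k)) / (δ * (2 * k))) := by gcongr
    _ = _ := by field_simp

/-- The sinc quadrature converges at the rate `exp (-π² / (2 k))`, uniformly on `[x₀, ∞)`. -/
theorem exists_abs_rpow_sub_sincScalar_le {β x₀ k₀ : ℝ} (hβ : 0 < β) (hβ1 : β < 1) (hx₀ : 0 < x₀)
    (hk₀ : 0 < k₀) : ∃ C : ℝ, 0 < C ∧ ∀ k, 0 < k → k < k₀ → ∀ x, x₀ ≤ x →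
      |x ^ (-β) - sincScalar β k x| ≤ C * Real.exp (-Real.pi ^ 2 / (2 * k)) := by
  have hρ0 : Real.exp (-(Real.pi ^ 2 / k₀)) < 1 := by simp; positivity
  have hβ' : 0 < 1 - β := by linarith
  refine ⟨x₀ ^ (-β) * (4 * Real.pi / (1 - Real.exp (-(Real.pi ^ 2 / k₀))) ^ 2) +
    x₀⁻¹ * (1 - β)⁻¹ + β⁻¹, by positivity, fun k hk hkk x hx => ?_⟩
  have hx0 : 0 < x := hx₀.trans_le hx
  set a := Real.log x with ha
  have hxa : x = Real.exp a := (Real.exp_log hx0).symm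
  set E := Real.exp (-Real.pi ^ 2 / (2 * k)) with hE
  set g : ℤ → ℝ := fun l => Real.exp (β * (2 * k * l + a)) * (1 + Real.exp (2 * k * l + a))⁻¹ with hg
  obtain ⟨hsum, htrap⟩ := summable_and_abs_trapezoid_sub_le hβ hβ1 (by positivity : 0 < 2 * k) a
  have hg0 : ∀ l, 0 ≤ g l := fun l => by positivity
  have hc1 : 0 ≤ ⌈Real.pi ^ 2 / (4 * (1 - β) * k ^ 2)⌉ := Int.ceil_nonneg (by positivity)
  have hc2 : 0 ≤ ⌈Real.pi ^ 2 / (4 * β * k ^ 2)⌉ := Int.ceil_nonneg (by positivity)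
  -- The right tail uses `(1 + e^t)⁻¹ ≤ e^(-t)`, the left tail `(1 + e^t)⁻¹ ≤ 1`; the weights `A`
  -- and `B` come from the shift by `log x`.
  obtain ⟨ht0, ht1⟩ := tsum_sub_sum_Icc_bounds hsum hg0 (A := x ^ (β - 1)) (B := x ^ β)
    (by positivity : 0 < (1 - β) * (2 * k)) (by positivity : 0 < β * (2 * k)) _ _ hc1 hc2
    (fun l => by
      have : (1 + Real.exp (2 * k * l + a))⁻¹ ≤ Real.exp (-(2 * k * l + a)) := by
        rw [Real.exp_neg]; exact inv_anti₀ (Real.exp_pos _) (by linarith)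
      calc g l ≤ Real.exp (β * (2 * k * l + a)) * Real.exp (-(2 * k * l + a)) := by
            simp only [hg]; gcongr
        _ = _ := by
            rw [Real.rpow_def_of_pos hx0, ← ha, ← Real.exp_add, ← Real.exp_add]; ring_nf)
    (fun l => by
      have : (1 + Real.exp (2 * k * l + a))⁻¹ ≤ 1 :=
        inv_le_one_of_one_le₀ (by linarith [Real.exp_pos (2 * k * l + a)])
      calc g l ≤ Real.exp (β * (2 * k * l + a)) * 1 := by
            simp only [hg]; gcongr
        _ = _ := by
            rw [mul_one, Real.rpow_def_of_pos hx0, ← ha, ← Real.exp_add]; ring_nf)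
  set T := ∑' l, g l
  set F := ∑ l ∈ Finset.Icc (-⌈Real.pi ^ 2 / (4 * β * k ^ 2)⌉)
    ⌈Real.pi ^ 2 / (4 * (1 - β) * k ^ 2)⌉, g l with hF
  have hsin : 0 < Real.sin (Real.pi * β) :=
    Real.sin_pos_of_pos_of_lt_pi (by positivity) (by nlinarith [Real.pi_pos])
  have hS : sincScalar β k x = x ^ (-β) * (Real.sin (Real.pi * β) / Real.pi) * (2 * k * F) := by
    have : F = x ^ β * ∑ l ∈ Finset.Icc (-⌈Real.pi ^ 2 / (4 * β * k ^ 2)⌉)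
        ⌈Real.pi ^ 2 / (4 * (1 - β) * k ^ 2)⌉,
        Real.exp (2 * β * (l * k)) * (1 + Real.exp (2 * (l * k)) * x)⁻¹ := by
      rw [hF, Finset.mul_sum]
      refine Finset.sum_congr rfl fun l _ => ?_
      simp only [hg]
      rw [Real.rpow_def_of_pos hx0, ← ha, ← mul_assoc, ← Real.exp_add]
      congr 2
      · ring_nf
      · rw [Real.exp_add, ← hxa]; ring_nf
    have h1 : x ^ (-β) * x ^ β = 1 := by rw [← Real.rpow_add hx0]; simp
    rw [sincScalar, this]
    linear_combination (-(2 * k * Real.sin (Real.pi * β) / Real.pi) *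
      ∑ l ∈ Finset.Icc (-⌈Real.pi ^ 2 / (4 * β * k ^ 2)⌉) ⌈Real.pi ^ 2 / (4 * (1 - β) * k ^ 2)⌉,
        Real.exp (2 * β * (l * k)) * (1 + Real.exp (2 * (l * k)) * x)⁻¹) * h1
  have hdiff : x ^ (-β) - sincScalar β k x = x ^ (-β) * (Real.sin (Real.pi * β) / Real.pi) *
      (-(2 * k * T - Real.pi / Real.sin (Real.pi * β)) + 2 * k * (T - F)) := by
    have hss : Real.sin (Real.pi * β) / Real.pi * (Real.pi / Real.sin (Real.pi * β)) = 1 :=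
      (div_mul_div_cancel₀ Real.pi_ne_zero).trans (div_self hsin.ne')
    rw [hS]
    linear_combination -(x ^ (-β)) * hss
  have hsinpi : Real.sin (Real.pi * β) / Real.pi ≤ 1 := by
    rw [div_le_one Real.pi_pos]
    linarith [Real.sin_le_one (Real.pi * β), Real.pi_gt_three]
  have hy : 2 * Real.pi ^ 2 / (2 * k) = Real.pi ^ 2 / k := by field_simp
  rw [hy] at htrap
  have htrap' : |2 * k * T - Real.pi / Real.sin (Real.pi * β)| ≤
      4 * Real.pi / (1 - Real.exp (-(Real.pi ^ 2 / k₀))) ^ 2 * E := by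
    refine htrap.trans ?_
    rw [mul_div_right_comm]
    have h1 : Real.exp (-(Real.pi ^ 2 / k)) ≤ Real.exp (-(Real.pi ^ 2 / k₀)) := by gcongr
    have h2 : Real.exp (-(Real.pi ^ 2 / k)) ≤ E := by
      rw [hE, neg_div]
      gcongr
      linarith
    have h3 : 0 < 1 - Real.exp (-(Real.pi ^ 2 / k₀)) := by linarith
    gcongr
  have htail : 2 * k * (T - F) ≤ x ^ (β - 1) * ((1 - β)⁻¹ * E) + x ^ β * (β⁻¹ * E) := by
    have m1 := mul_le_mul_of_nonneg_left (mul_exp_div_exp_sub_one_le hβ' hk)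
      (Real.rpow_nonneg hx0.le (β - 1))
    have m2 := mul_le_mul_of_nonneg_left (mul_exp_div_exp_sub_one_le hβ hk)
      (Real.rpow_nonneg hx0.le β)
    have m3 := mul_le_mul_of_nonneg_left ht1 (by positivity : 0 ≤ 2 * k)
    linarith
  have htail0 : 0 ≤ 2 * k * (T - F) := by positivity
  -- The prefactor `x^(-β)` reduces the tail weights to `1` and `x⁻¹`, both bounded on `[x₀, ∞)`.
  have r1 : x ^ (-β) * x ^ β = 1 := by rw [← Real.rpow_add hx0]; simp
  have r2 : x ^ (-β) * x ^ (β - 1) = x⁻¹ := by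
    rw [← Real.rpow_add hx0, ← Real.rpow_neg_one]; ring_nf
  have r3 : x ^ (-β) ≤ x₀ ^ (-β) := Real.rpow_le_rpow_of_nonpos hx₀ hx (by linarith)
  have r4 : x⁻¹ ≤ x₀⁻¹ := inv_anti₀ hx₀ hx
  have hE0 : 0 < E := Real.exp_pos _
  calc _ = x ^ (-β) * (Real.sin (Real.pi * β) / Real.pi) *
        |-(2 * k * T - Real.pi / Real.sin (Real.pi * β)) + 2 * k * (T - F)| := by
        rw [hdiff, abs_mul, abs_of_nonneg (by positivity)]
    _ ≤ x ^ (-β) * 1 * (|2 * k * T - Real.pi / Real.sin (Real.pi * β)| + 2 * k * (T - F)) := by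
        gcongr
        refine (abs_add_le _ _).trans ?_
        rw [abs_neg, abs_of_nonneg htail0]
    _ ≤ x ^ (-β) * 1 * (4 * Real.pi / (1 - Real.exp (-(Real.pi ^ 2 / k₀))) ^ 2 * E +
          (x ^ (β - 1) * ((1 - β)⁻¹ * E) + x ^ β * (β⁻¹ * E))) := by gcongr
    _ = (x ^ (-β) * (4 * Real.pi / (1 - Real.exp (-(Real.pi ^ 2 / k₀))) ^ 2) +
          x⁻¹ * (1 - β)⁻¹ + β⁻¹) * E := by
        linear_combination (1 - β)⁻¹ * E * r2 + β⁻¹ * E * r1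
    _ ≤ _ := by gcongr

/-! ### Power sums, their tails and the logarithmic borderline case. -/

/-- For `p ≥ 0` each term is at most `N^p`. For `p < 0` Bernoulli's inequality gives the telescoping
bound `(1 + p) (n + 1)^p ≤ (n + 1)^(1 + p) - n^(1 + p)`. -/
theorem sum_rpow_le_of_neg_one_lt {p : ℝ} (hp : -1 < p) :
    ∃ C : ℝ, 0 < C ∧ ∀ N : ℕ, ∑ j ∈ Finset.range N, ((j : ℝ) + 1) ^ p ≤ C * (N : ℝ) ^ (1 + p) := by
  have hp1 : 0 < 1 + p := by linarith
  rcases le_or_gt 0 p with h0 | h0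
  · refine ⟨1, one_pos, fun N => ?_⟩
    have : ∀ j ∈ Finset.range N, ((j : ℝ) + 1) ^ p ≤ (N : ℝ) ^ p := fun j hj => by
      have : (j : ℝ) + 1 ≤ N := by exact_mod_cast Finset.mem_range.1 hj
      gcongr
    refine (Finset.sum_le_card_nsmul _ _ _ this).trans (le_of_eq ?_)
    rw [Finset.card_range, nsmul_eq_mul, one_mul, Real.rpow_add_of_nonneg N.cast_nonneg one_pos.le h0,
      Real.rpow_one]
  · refine ⟨(1 + p)⁻¹, by positivity, fun N => ?_⟩
    rw [inv_mul_eq_div, le_div_iff₀ hp1]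
    induction N with
    | zero => simp [Real.zero_rpow hp1.ne']
    | succ n ih =>
      rw [Finset.sum_range_succ, add_mul]
      have hn : (0 : ℝ) < n + 1 := by positivity
      have hB := rpow_one_add_le_one_add_mul_self (s := -((n : ℝ) + 1)⁻¹) (p := 1 + p)
        (by
          have : ((n : ℝ) + 1)⁻¹ ≤ 1 := inv_le_one_of_one_le₀ (by linarith [n.cast_nonneg (α := ℝ)])
          linarith) hp1.le (by linarith)
      have e : (1 : ℝ) + -((n : ℝ) + 1)⁻¹ = n / (n + 1) := by field_simp; ring
      rw [e, Real.div_rpow n.cast_nonneg hn.le, div_le_iff₀ (by positivity)] at hB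
      have e2 : ((n : ℝ) + 1) ^ (1 + p) = (n + 1) * ((n : ℝ) + 1) ^ p := by
        rw [Real.rpow_add hn, Real.rpow_one]
      have e3 : ((n : ℝ) + 1)⁻¹ * ((n : ℝ) + 1) ^ (1 + p) = ((n : ℝ) + 1) ^ p := by
        rw [e2, inv_mul_cancel_left₀ hn.ne']
      push_cast
      linear_combination ih + hB - (1 + p) * e3

theorem sum_rpow_le_of_lt_neg_one {p : ℝ} (hp : p < -1) :
    ∃ C : ℝ, 0 < C ∧ ∀ N : ℕ, ∑ j ∈ Finset.range N, ((j : ℝ) + 1) ^ p ≤ C := by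
  have hs : Summable fun j : ℕ => ((j : ℝ) + 1) ^ p := by
    have := (summable_nat_add_iff 1).2 (Real.summable_nat_rpow.2 hp)
    simpa using this
  refine ⟨∑' j : ℕ, ((j : ℝ) + 1) ^ p, hs.tsum_pos (fun j => by positivity) 0 (by simp), fun N => ?_⟩
  exact hs.sum_le_tsum _ fun j _ => by positivity

theorem sum_rpow_neg_one_le (N : ℕ) :
    ∑ j ∈ Finset.range N, ((j : ℝ) + 1) ^ (-1 : ℝ) ≤ 1 + Real.log N := by
  refine le_trans (le_of_eq ?_) (harmonic_le_one_add_log N)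
  simp [harmonic, Real.rpow_neg_one]

theorem tsum_rpow_tail_le {p : ℝ} (hp : 1 < p) {N : ℕ} (hN : 0 < N) :
    ∑' j : ℕ, (((j + N : ℕ) : ℝ) + 1) ^ (-p) ≤ (p - 1)⁻¹ * (N : ℝ) ^ (1 - p) := by
  have hp1 : 0 < p - 1 := by linarith
  have hN0 : (0 : ℝ) < N := by exact_mod_cast hN
  -- Telescoping of `(p - 1) (x + 1)^(-p) ≤ x^(1 - p) - (x + 1)^(1 - p)`; the leftover power is kept
  -- on the left so that the induction closes.
  have key : ∀ M : ℕ, (p - 1) * ∑ j ∈ Finset.range M, (((j + N : ℕ) : ℝ) + 1) ^ (-p) +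
      ((M + N : ℕ) : ℝ) ^ (1 - p) ≤ (N : ℝ) ^ (1 - p) := fun M => by
    induction M with
    | zero => simp
    | succ n ih =>
      rw [Finset.sum_range_succ]
      set x : ℝ := ((n + N : ℕ) : ℝ) with hx
      have hx0 : 0 < x := by rw [hx]; positivity
      have hc : ((n + 1 + N : ℕ) : ℝ) = x + 1 := by rw [hx]; push_cast; ring
      rw [hc]
      have h1 : Real.log (x / (x + 1)) ≤ x / (x + 1) - 1 := Real.log_le_sub_one_of_pos (by positivity)
      have h2 : 1 + (p - 1) * (x + 1)⁻¹ ≤ (x / (x + 1)) ^ (1 - p) := by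
        rw [Real.rpow_def_of_pos (by positivity)]
        refine le_trans ?_ (Real.add_one_le_exp _)
        have : x / (x + 1) - 1 = -(x + 1)⁻¹ := by field_simp; ring
        rw [this] at h1
        nlinarith
      rw [Real.div_rpow hx0.le (by positivity), le_div_iff₀ (by positivity)] at h2
      have e : (x + 1)⁻¹ * (x + 1) ^ (1 - p) = (x + 1) ^ (-p) := by
        rw [← Real.rpow_neg_one, ← Real.rpow_add (by positivity)]
        ring_nf
      linear_combination ih + h2 - (p - 1) * e
  refine Real.tsum_le_of_sum_range_le (fun j => by positivity) fun M => ?_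
  rw [inv_mul_eq_div, le_div_iff₀ hp1]
  have : 0 ≤ ((M + N : ℕ) : ℝ) ^ (1 - p) := by positivity
  linarith [key M]

/-- Since `h₀ < 1`, `|ln h|` is bounded below on `(0, h₀)`, so a bound free of logarithms can always
be weakened to one carrying the factor `χ`. -/
theorem exists_one_le_mul_of_one_or_log {h₀ : ℝ} (hh₀ : 0 < h₀) (hh₁ : h₀ < 1) {χ : ℝ → ℝ}
    (hχ : ∀ h, 0 < h → h < h₀ → χ h = 1 ∨ χ h = |Real.log h|) :
    ∃ b : ℝ, 0 < b ∧ ∀ h, 0 < h → h < h₀ → 1 ≤ b * χ h := by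
  have hlog₀ : 0 < |Real.log h₀| := abs_pos.2 (Real.log_neg hh₀ hh₁).ne
  refine ⟨max 1 |Real.log h₀|⁻¹, by positivity, fun h h0 h1 => ?_⟩
  rcases hχ h h0 h1 with e | e <;> rw [e]
  · simp
  · have hlog : |Real.log h₀| ≤ |Real.log h| := by
      rw [abs_of_neg (Real.log_neg hh₀ hh₁), abs_of_neg (Real.log_neg h0 (h1.trans hh₁))]
      exact neg_le_neg (Real.log_le_log h0 h1.le)
    calc (1 : ℝ) = |Real.log h₀|⁻¹ * |Real.log h₀| := (inv_mul_cancel₀ hlog₀.ne').symm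
      _ ≤ _ := mul_le_mul (le_max_right _ _) hlog hlog₀.le (by positivity)

/-- Power sums over at most `c h ^ (-δ)` terms, weighted by `h ^ ρ`, are of order `h ^ m`, with a
logarithm in the borderline case. -/
theorem rpow_mul_sum_rpow_le {δ c h₀ m ρ p : ℝ} (hδ : 0 < δ) (hc : 0 < c) (hh₀ : 0 < h₀)
    (hh₁ : h₀ < 1) (hm : m ≤ ρ) (hm' : m ≤ ρ - δ * (1 + p)) {χ : ℝ → ℝ}
    (hχ : ∀ h, 0 < h → h < h₀ → χ h = 1 ∨ χ h = |Real.log h|)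
    (hcrit : p = -1 → m = ρ → ∀ h, 0 < h → h < h₀ → χ h = |Real.log h|) :
    ∃ C : ℝ, 0 < C ∧ ∀ h : ℝ, 0 < h → h < h₀ → ∀ N : ℕ, (N : ℝ) ≤ c * h ^ (-δ) →
      h ^ ρ * ∑ j ∈ Finset.range N, ((j : ℝ) + 1) ^ p ≤ C * (h ^ m * χ h) := by
  have hlog₀ : 0 < |Real.log h₀| := abs_pos.2 (Real.log_neg hh₀ hh₁).ne
  have hlog : ∀ h, 0 < h → h < h₀ → |Real.log h₀| ≤ |Real.log h| := fun h h0 h1 => by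
    rw [abs_of_neg (Real.log_neg hh₀ hh₁), abs_of_neg (Real.log_neg h0 (h1.trans hh₁))]
    exact neg_le_neg (Real.log_le_log h0 h1.le)
  obtain ⟨b, hb, hbχ⟩ := exists_one_le_mul_of_one_or_log hh₀ hh₁ hχ
  rcases lt_trichotomy p (-1) with hp | hp | hp
  · obtain ⟨C, hC, hS⟩ := sum_rpow_le_of_lt_neg_one hp
    refine ⟨C * b, by positivity, fun h h0 h1 N _ => ?_⟩
    calc _ ≤ h ^ m * C * 1 := by
          rw [mul_one]
          exact mul_le_mul (Real.rpow_le_rpow_of_exponent_ge h0 (h1.trans hh₁).le hm) (hS N)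
            (by positivity) (by positivity)
      _ ≤ h ^ m * C * (b * χ h) := by gcongr; exact hbχ h h0 h1
      _ = _ := by ring
  · subst hp
    obtain ⟨C, hC, hS⟩ : ∃ C : ℝ, 0 < C ∧ ∀ h : ℝ, 0 < h → h < h₀ → ∀ N : ℕ, (N : ℝ) ≤ c * h ^ (-δ) →
        ∑ j ∈ Finset.range N, ((j : ℝ) + 1) ^ (-1 : ℝ) ≤ C * |Real.log h| := by
      refine ⟨(1 + |Real.log c|) * |Real.log h₀|⁻¹ + δ, by positivity, fun h h0 h1 N hN => ?_⟩
      rcases Nat.eq_zero_or_pos N with rfl | hN0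
      · simp; positivity
      have hl := Real.log_le_log (by exact_mod_cast hN0) hN
      rw [Real.log_mul hc.ne' (Real.rpow_pos_of_pos h0 _).ne', Real.log_rpow h0] at hl
      have e := abs_of_neg (Real.log_neg h0 (h1.trans hh₁))
      calc _ ≤ 1 + Real.log N := sum_rpow_neg_one_le N
        _ ≤ (1 + |Real.log c|) * (|Real.log h₀|⁻¹ * |Real.log h₀|) + δ * |Real.log h| := by
          rw [inv_mul_cancel₀ hlog₀.ne', e]
          linarith [le_abs_self (Real.log c)]
        _ ≤ (1 + |Real.log c|) * (|Real.log h₀|⁻¹ * |Real.log h|) + δ * |Real.log h| := by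
          have := mul_le_mul_of_nonneg_left (hlog h h0 h1) (inv_pos.2 hlog₀).le
          gcongr ?_ + _
          exact mul_le_mul_of_nonneg_left this (by positivity)
        _ = _ := by ring
    -- A spare power `h^(ρ - m)` absorbs the logarithm; only `m = ρ` has to keep it.
    rcases hm.eq_or_lt with hmρ | hmρ
    · refine ⟨C, hC, fun h h0 h1 N hN => ?_⟩
      rw [hcrit rfl hmρ h h0 h1, hmρ]
      calc _ ≤ h ^ ρ * (C * |Real.log h|) := by gcongr; exact hS h h0 h1 N hN
        _ = _ := by ring
    · refine ⟨C * (1 / (ρ - m)) * b, by have := sub_pos.2 hmρ; positivity, fun h h0 h1 N hN => ?_⟩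
      have hd := sub_pos.2 hmρ
      have hlogr := Real.abs_log_mul_self_rpow_lt h (ρ - m) h0 (h1.trans hh₁).le hd
      rw [abs_mul, abs_of_pos (Real.rpow_pos_of_pos h0 _)] at hlogr
      have e : h ^ ρ = h ^ m * h ^ (ρ - m) := by rw [← Real.rpow_add h0]; ring_nf
      calc _ ≤ h ^ ρ * (C * |Real.log h|) := by gcongr; exact hS h h0 h1 N hN
        _ = h ^ m * C * (|Real.log h| * h ^ (ρ - m)) * 1 := by rw [e]; ring
        _ ≤ h ^ m * C * (1 / (ρ - m)) * (b * χ h) := by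
          gcongr
          exact hbχ h h0 h1
        _ = _ := by ring
  · obtain ⟨C, hC, hS⟩ := sum_rpow_le_of_neg_one_lt hp
    have hp1 : 0 < 1 + p := by linarith
    refine ⟨C * c ^ (1 + p) * b, by positivity, fun h h0 h1 N hN => ?_⟩
    calc _ ≤ h ^ ρ * (C * (c * h ^ (-δ)) ^ (1 + p)) := by
          gcongr
          refine (hS N).trans ?_
          gcongr
      _ = C * c ^ (1 + p) * h ^ (ρ - δ * (1 + p)) * 1 := by
          rw [Real.mul_rpow hc.le (by positivity), ← Real.rpow_mul h0.le, sub_eq_add_neg,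
            Real.rpow_add h0]
          ring_nf
      _ ≤ C * c ^ (1 + p) * h ^ m * (b * χ h) := by
          gcongr ?_ * ?_
          · gcongr _ * ?_
            exact Real.rpow_le_rpow_of_exponent_ge h0 (h1.trans hh₁).le hm'
          · exact hbχ h h0 h1
      _ = _ := by ring

/-! ### Second moments of shifted standard normal variables. -/

section Gaussian

variable {Ω : Type*} [MeasurableSpace Ω] {P : Measure Ω} {X : Ω → ℝ}

theorem memLp_two_of_hasLaw_gaussianReal (hX : HasLaw X (gaussianReal 0 1) P) : MemLp X 2 P := by
  have h : MemLp id 2 (gaussianReal 0 1) := memLp_id_gaussianReal 2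
  rw [← hX.map_eq] at h
  exact h.comp_of_map hX.aemeasurable

theorem integrable_add_sq [IsProbabilityMeasure P] (hX : HasLaw X (gaussianReal 0 1) P) (c : ℝ) :
    Integrable (fun ω => (c + X ω) ^ 2) P :=
  ((memLp_const c).add (memLp_two_of_hasLaw_gaussianReal hX)).integrable_sq

theorem integral_add_sq [IsProbabilityMeasure P] (hX : HasLaw X (gaussianReal 0 1) P) (c : ℝ) :
    ∫ ω, (c + X ω) ^ 2 ∂P = c ^ 2 + 1 := by
  have hL := memLp_two_of_hasLaw_gaussianReal hX
  have h1 : ∫ ω, X ω ∂P = 0 := by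
    rw [hX.integral_eq]; exact integral_id_gaussianReal
  have h2 : ∫ ω, X ω ^ 2 ∂P = 1 := by
    have hv := hX.variance_eq
    rw [variance_id_gaussianReal, variance_eq_sub hL, h1] at hv
    simpa using hv
  have e : ∀ ω, (c + X ω) ^ 2 = c ^ 2 + (2 * c * X ω + X ω ^ 2) := fun ω => by ring
  simp_rw [e]
  have hi : Integrable X P := hL.integrable one_le_two
  have hi2 : Integrable (fun ω => 2 * c * X ω + X ω ^ 2) P := (hi.const_mul _).add hL.integrable_sq
  rw [integral_add (integrable_const _) hi2,
    integral_add (hi.const_mul _) hL.integrable_sq, integral_const_mul, h1, h2]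
  simp

end Gaussian

/-! ### Spectral coefficients and second moment of the exact solution. -/

namespace OrderedEigenbasis

variable {H : Type*} [NormedAddCommGroup H] [InnerProductSpace ℝ H] [CompleteSpace H]
  {L : H →ₗ.[ℝ] H} (S : OrderedEigenbasis L)

theorem basis_mem_powDomain (γ : ℝ) (j : ℕ) : S.basis j ∈ S.powDomain γ := by
  rw [mem_powDomain]
  refine summable_of_ne_finset_zero (s := {j}) fun i hi => ?_
  rw [S.basis.orthonormal.2 (by simpa using hi)]
  simp

/-- An eigenvector `e_j` as an element of `Ḣ^{2γ}`. -/
def basisHDot (γ : ℝ) (j : ℕ) : S.HDot γ := (⟨S.basis j, S.basis_mem_powDomain γ j⟩ : S.powDomain γ)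

theorem powLin_basisHDot (γ : ℝ) (j : ℕ) :
    S.powLin γ (S.basisHDot γ j) = S.eig j ^ γ • S.basis j := by
  apply S.basis.repr.injective
  ext i
  rw [S.basis.repr_apply_apply, S.basis.repr_apply_apply, inner_smul_right]
  refine (S.inner_basis_pow γ ⟨S.basis j, S.basis_mem_powDomain γ j⟩ i).trans ?_
  rcases eq_or_ne i j with rfl | h
  · rfl
  · simp only [S.basis.orthonormal.2 h, mul_zero]

theorem toDual_basisHDot (γ : ℝ) (hγ : 0 ≤ γ) (x : H) (j : ℕ) :
    S.toDual γ hγ x (S.basisHDot γ j) = inner ℝ x (S.basis j) := rfl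

theorem powExt_basisHDot (γ : ℝ) (x : H) (j : ℕ) :
    S.powExt γ x (S.basisHDot γ j) = S.eig j ^ γ * inner ℝ x (S.basis j) := by
  have : S.powExt γ x (S.basisHDot γ j) = inner ℝ x (S.powLin γ (S.basisHDot γ j)) := rfl
  rw [this, powLin_basisHDot, inner_smul_right]

theorem inner_truncNoise_basis {Ω : Type*} (ξ : ℕ → Ω → ℝ) {N j : ℕ} (hj : j < N) (ω : Ω) :
    inner ℝ (S.truncNoise ξ N ω) (S.basis j) = ξ j ω := by
  rw [truncNoise, sum_inner, Finset.sum_eq_single j]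
  · rw [inner_smul_left, real_inner_self_eq_norm_sq, S.basis.orthonormal.1]
    simp
  · intro i _ hi
    rw [inner_smul_left, S.basis.orthonormal.2 hi, mul_zero]
  · intro h
    exact absurd (Finset.mem_range.2 hj) h

section Noise

variable {S} {Ω : Type*} [MeasurableSpace Ω] {P : Measure Ω}

/-- Evaluation at `e_j` is continuous on the dual, and every truncation with `N > j` takes the value
`ξ_j` there. The `L²` distance is therefore bounded by a null sequence. -/
theorem IsWhiteNoise.ae_apply_basisHDot {γ : ℝ} {hγ : 0 ≤ γ} {ξ : ℕ → Ω → ℝ}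
    {W : Ω → S.HDotDual γ} (hW : S.IsWhiteNoise P γ hγ ξ W) {j : ℕ}
    (hξ : AEStronglyMeasurable (ξ j) P) : ∀ᵐ ω ∂P, W ω (S.basisHDot γ j) = ξ j ω := by
  have hmeas : AEStronglyMeasurable (fun ω => W ω (S.basisHDot γ j) - ξ j ω) P :=
    ((ContinuousLinearMap.apply ℝ ℝ (S.basisHDot γ j)).continuous.comp_aestronglyMeasurable
      hW.memLp.1).sub hξ
  have hle : ∀ N, j < N → eLpNorm (fun ω => W ω (S.basisHDot γ j) - ξ j ω) 2 P ≤
      ENNReal.ofReal ‖S.basisHDot γ j‖ *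
        eLpNorm (fun ω => W ω - S.toDual γ hγ (S.truncNoise ξ N ω)) 2 P := fun N hN => by
    refine eLpNorm_le_mul_eLpNorm_of_ae_le_mul (Eventually.of_forall fun ω => ?_) 2
    have h := (W ω - S.toDual γ hγ (S.truncNoise ξ N ω)).le_opNorm (S.basisHDot γ j)
    rwa [sub_apply, toDual_basisHDot, S.inner_truncNoise_basis ξ hN, mul_comm] at h
  have hlim := ENNReal.Tendsto.const_mul hW.tendsto
    (Or.inr (ENNReal.ofReal_ne_top (r := ‖S.basisHDot γ j‖)))
  rw [mul_zero] at hlim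
  have h0 := ge_of_tendsto hlim ((eventually_gt_atTop j).mono hle)
  have h1 := (eLpNorm_eq_zero_iff hmeas two_ne_zero).1 (le_antisymm h0 zero_le)
  filter_upwards [h1] with ω hω
  exact sub_eq_zero.1 hω

theorem IsSolution.ae_inner_basis {β : ℝ} {hβ : 0 ≤ β} {g : H} {ξ : ℕ → Ω → ℝ}
    {W : Ω → S.HDotDual β} {u : Ω → H} (hu : S.IsSolution P β hβ g W u)
    (hW : S.IsWhiteNoise P β hβ ξ W) (hξ : ∀ j, AEStronglyMeasurable (ξ j) P) :
    ∀ᵐ ω ∂P, ∀ j, inner ℝ (S.basis j) (u ω) =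
      S.eig j ^ (-β) * (inner ℝ (S.basis j) g + ξ j ω) := by
  filter_upwards [hu.eq, ae_all_iff.2 fun j => hW.ae_apply_basisHDot (hξ j)] with ω h1 h2 j
  have h3 := DFunLike.congr_fun h1 (S.basisHDot β j)
  rw [add_apply, powExt_basisHDot, toDual_basisHDot, h2, real_inner_comm,
    real_inner_comm (S.basis j) g] at h3
  rw [← h3, ← mul_assoc, ← Real.rpow_add (S.eig_pos j)]
  simp

theorem hasSum_sq_inner (x : H) : HasSum (fun j => (inner ℝ (S.basis j) x) ^ 2) (‖x‖ ^ 2) := by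
  rw [← real_inner_self_eq_norm_sq]
  simpa only [sq, real_inner_comm x] using S.basis.hasSum_inner_mul_inner x x

/-- Parseval pointwise in `ω`, then Tonelli. Lower integrals are used so that square integrability
is a consequence of the finite sum. -/
theorem IsSolution.memLp_and_integral [IsProbabilityMeasure P] {β : ℝ} {hβ : 0 ≤ β} {g : H}
    {ξ : ℕ → Ω → ℝ} {W : Ω → S.HDotDual β} {u : Ω → H} (hu : S.IsSolution P β hβ g W u)
    (hW : S.IsWhiteNoise P β hβ ξ W) (hξ : ∀ j, HasLaw (ξ j) (gaussianReal 0 1) P)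
    (hsum : Summable fun j => S.eig j ^ (-(2 * β))) :
    MemLp u 2 P ∧
      HasSum (fun j => S.eig j ^ (-(2 * β)) * (inner ℝ (S.basis j) g ^ 2 + 1)) (∫ ω, ‖u ω‖ ^ 2 ∂P) := by
  set a : ℕ → ℝ := fun j => S.eig j ^ (-(2 * β)) * (inner ℝ (S.basis j) g ^ 2 + 1) with ha
  have ha0 : ∀ j, 0 ≤ a j := fun j => mul_nonneg (Real.rpow_nonneg (S.eig_pos j).le _) (by positivity)
  have hasum : Summable a := by
    refine Summable.of_nonneg_of_le ha0 (fun j => ?_) (hsum.mul_left (‖g‖ ^ 2 + 1))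
    have h1 : inner ℝ (S.basis j) g ^ 2 ≤ ‖g‖ ^ 2 :=
      le_hasSum (hasSum_sq_inner g) j fun i _ => sq_nonneg _
    calc a j = (inner ℝ (S.basis j) g ^ 2 + 1) * S.eig j ^ (-(2 * β)) := mul_comm _ _
      _ ≤ _ := mul_le_mul_of_nonneg_right (by linarith) (Real.rpow_nonneg (S.eig_pos j).le _)
  have hcoef := hu.ae_inner_basis hW fun j => (hξ j).aemeasurable.aestronglyMeasurable
  have hF : ∀ j, ∫⁻ ω, ENNReal.ofReal (inner ℝ (S.basis j) (u ω) ^ 2) ∂P = ENNReal.ofReal (a j) := by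
    intro j
    have h1 : ∀ᵐ ω ∂P, ENNReal.ofReal (inner ℝ (S.basis j) (u ω) ^ 2) =
        ENNReal.ofReal (S.eig j ^ (-(2 * β)) * (inner ℝ (S.basis j) g + ξ j ω) ^ 2) := by
      filter_upwards [hcoef] with ω hω
      rw [hω j, mul_pow, ← Real.rpow_natCast (_ ^ (-β)), ← Real.rpow_mul (S.eig_pos j).le]
      congr 3
      push_cast
      ring
    rw [lintegral_congr_ae h1, ← ofReal_integral_eq_lintegral_ofReal
      ((integrable_add_sq (hξ j) _).const_mul _)
      (Eventually.of_forall fun ω => mul_nonneg (Real.rpow_nonneg (S.eig_pos j).le _) (sq_nonneg _)),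
      integral_const_mul, integral_add_sq (hξ j)]
  have hmeas : AEStronglyMeasurable (fun ω => ‖u ω‖ ^ 2) P := (hu.aestronglyMeasurable.norm).pow 2
  have hL : ∫⁻ ω, ENNReal.ofReal (‖u ω‖ ^ 2) ∂P = ENNReal.ofReal (∑' j, a j) := by
    rw [ENNReal.ofReal_tsum_of_nonneg ha0 hasum]
    simp_rw [← hF]
    rw [← lintegral_tsum]
    · refine lintegral_congr fun ω => ?_
      rw [← (hasSum_sq_inner (S := S) (u ω)).tsum_eq,
        ENNReal.ofReal_tsum_of_nonneg (fun _ => sq_nonneg _) (hasSum_sq_inner (u ω)).summable]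
    · intro j
      have : AEStronglyMeasurable (fun ω => inner ℝ (S.basis j) (u ω)) P :=
        aestronglyMeasurable_const.inner hu.aestronglyMeasurable
      exact (this.pow 2).aemeasurable.ennreal_ofReal
  have hint : Integrable (fun ω => ‖u ω‖ ^ 2) P := by
    refine ⟨hmeas, ?_⟩
    rw [hasFiniteIntegral_iff_ofReal (Eventually.of_forall fun ω => sq_nonneg _), hL]
    exact ENNReal.ofReal_lt_top
  refine ⟨(memLp_two_iff_integrable_sq_norm hu.aestronglyMeasurable).2 hint, ?_⟩
  rw [integral_eq_lintegral_of_nonneg_ae (Eventually.of_forall fun ω => sq_nonneg _) hmeas, hL,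
    ENNReal.toReal_ofReal (tsum_nonneg ha0)]
  exact hasum.hasSum

end Noise

/-! ### Action of the quadrature operator on discrete eigenvectors. -/

section Galerkin

variable (V : Submodule ℝ H) [FiniteDimensional ℝ V]

/-- Pairing with `x` gives `‖x‖² + c ‖L^(1/2) x‖² = 0` on the kernel, and injectivity suffices in
finite dimension. Invertibility matters because `Ring.inverse` is zero on non-units. -/
theorem isUnit_one_add_smul_galerkin (hV : V ≤ S.powDomain (1 / 2)) {c : ℝ} (hc : 0 ≤ c) :
    IsUnit ((1 : Module.End ℝ V) + c • (S.galerkin V hV : Module.End ℝ V)) := by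
  rw [LinearMap.isUnit_iff_ker_eq_bot, LinearMap.ker_eq_bot']
  intro x hx
  have h : inner ℝ (x + c • S.galerkin V hV x) x = 0 := by
    have : x + c • S.galerkin V hV x = 0 := hx
    rw [this, inner_zero_left]
  rw [inner_add_left, inner_smul_left, inner_galerkin, real_inner_self_eq_norm_sq,
    real_inner_self_eq_norm_sq] at h
  have h2 : ‖x‖ ^ 2 = 0 := le_antisymm (by
    have : 0 ≤ c * ‖S.pow (1 / 2) ⟨x, hV x.2⟩‖ ^ 2 := by positivity
    simp only [conj_trivial] at h
    linarith) (sq_nonneg _)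
  simpa using h2

theorem ringInverse_apply_of_eigenvector {V : Type*} [AddCommGroup V] [Module ℝ V]
    {A : Module.End ℝ V} (hA : IsUnit A) {v : V} {c : ℝ} (hc : c ≠ 0) (h : A v = c • v) :
    Ring.inverse A v = c⁻¹ • v := by
  have h1 : Ring.inverse A (A v) = v := by
    rw [← Module.End.mul_apply, Ring.inverse_mul_cancel A hA, Module.End.one_apply]
  rw [h, map_smul] at h1
  rw [← h1, smul_smul, inv_mul_cancel₀ hc, one_smul, h1]

theorem sincQuadrature_galerkin_apply (hV : V ≤ S.powDomain (1 / 2)) (β k : ℝ) {v : V} {x : ℝ}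
    (hx : 0 ≤ x) (hv : S.galerkin V hV v = x • v) :
    sincQuadrature β k (S.galerkin V hV) v = sincScalar β k x • v := by
  rw [sincQuadrature, LinearMap.smul_apply, LinearMap.sum_apply, sincScalar, mul_smul,
    Finset.sum_smul]
  congr 1
  refine Finset.sum_congr rfl fun l _ => ?_
  rw [LinearMap.smul_apply, ringInverse_apply_of_eigenvector
    (S.isUnit_one_add_smul_galerkin V hV (Real.exp_pos _).le)
    (by positivity : 1 + Real.exp (2 * (l * k)) * x ≠ 0), smul_smul]
  rw [LinearMap.add_apply, LinearMap.smul_apply, hv, Module.End.one_apply, add_smul, one_smul, smul_smul]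

end Galerkin

end OrderedEigenbasis

/-! ### Second moment of the numerical solution. -/

section Discrete

variable {H : Type*} [NormedAddCommGroup H] [InnerProductSpace ℝ H] {Ω : Type*}
  {V : Submodule ℝ H} {N : ℕ} (eh : OrthonormalBasis (Fin N) ℝ V)

/-- `R` is the invertible transition matrix between `φ` and `eh`, so the coordinates in `eh` are `R
R⁻¹ ξ = ξ`. This removes all dependence on `φ`. -/
theorem discreteNoise_eq_sum (φ : Module.Basis (Fin N) ℝ V) (ξ : ℕ → Ω → ℝ) (ω : Ω) :
    discreteNoise eh φ ξ ω = ∑ i : Fin N, ξ i ω • eh i := by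
  have hR : (Matrix.of fun i j : Fin N => inner ℝ (eh i) (φ j)) = eh.toBasis.toMatrix φ := by
    ext i j
    rw [Module.Basis.toMatrix_apply, OrthonormalBasis.coe_toBasis_repr_apply, eh.repr_apply_apply]
    rfl
  have hinv : IsUnit (eh.toBasis.toMatrix φ) := by
    have := eh.toBasis.invertibleToMatrix φ
    exact isUnit_of_invertible _
  apply eh.repr.injective
  ext i
  rw [eh.repr_apply_apply, eh.repr_apply_apply, discreteNoise, eh.orthonormal.inner_right_fintype, inner_sum]
  simp only [inner_smul_right]
  have h : Matrix.mulVec (Matrix.of fun i j : Fin N => inner ℝ (eh i) (φ j))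
      (Matrix.mulVec (Matrix.of fun i j : Fin N => inner ℝ (eh i) (φ j))⁻¹
        (fun i : Fin N => ξ i ω)) = fun i : Fin N => ξ i ω := by
    rw [Matrix.mulVec_mulVec, hR, Matrix.mul_nonsing_inv _ ((Matrix.isUnit_iff_isUnit_det _).1 hinv),
      Matrix.one_mulVec]
  refine Eq.trans ?_ (congr_fun h i)
  rw [Matrix.mulVec, dotProduct]
  exact Finset.sum_congr rfl fun j _ => by rw [mul_comm]; rfl

theorem numericalSolution_eq_sum [FiniteDimensional ℝ V] {β k : ℝ} {Lh : V →ₗ[ℝ] V}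
    {Q : Fin N → ℝ} (hQ : ∀ j, sincQuadrature β k Lh (eh j) = Q j • eh j)
    (φ : Module.Basis (Fin N) ℝ V) (ξ : ℕ → Ω → ℝ) (g : H) (ω : Ω) :
    numericalSolution β k Lh eh φ ξ g ω =
      ((∑ j, (Q j * (inner ℝ (eh j : H) g + ξ j ω)) • eh j : V) : H) := by
  have hproj : V.orthogonalProjectionOnto g = ∑ j, inner ℝ (eh j : H) g • eh j := by
    rw [← eh.sum_repr (V.orthogonalProjectionOnto g)]
    refine Finset.sum_congr rfl fun j _ => ?_
    rw [eh.repr_apply_apply, Submodule.inner_orthogonalProjectionOnto_eq_of_mem_left]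
  rw [numericalSolution, discreteNoise_eq_sum, hproj, ← Finset.sum_add_distrib, map_sum]
  congr 1
  refine Finset.sum_congr rfl fun j _ => ?_
  rw [← add_smul, map_smul, hQ, smul_smul, mul_comm]

theorem memLp_and_integral_numericalSolution [FiniteDimensional ℝ V] [MeasurableSpace Ω]
    {P : Measure Ω} [IsProbabilityMeasure P] {β k : ℝ} {Lh : V →ₗ[ℝ] V}
    {Q : Fin N → ℝ} (hQ : ∀ j, sincQuadrature β k Lh (eh j) = Q j • eh j)
    (φ : Module.Basis (Fin N) ℝ V) {ξ : ℕ → Ω → ℝ}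
    (hξ : ∀ j, HasLaw (ξ j) (gaussianReal 0 1) P) (g : H) :
    MemLp (numericalSolution β k Lh eh φ ξ g) 2 P ∧
      ∫ ω, ‖numericalSolution β k Lh eh φ ξ g ω‖ ^ 2 ∂P =
        ∑ j, Q j ^ 2 * (inner ℝ (eh j : H) g ^ 2 + 1) := by
  have hfun := numericalSolution_eq_sum eh hQ φ ξ g
  constructor
  · rw [funext hfun]
    simp only [Submodule.coe_sum, Submodule.coe_smul]
    refine memLp_finsetSum Finset.univ
      (f := fun (j : Fin N) ω => (Q j * (inner ℝ (eh j : H) g + ξ j ω)) • (eh j : H)) fun j _ => ?_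
    have h1 : MemLp (fun ω => Q j * (inner ℝ (eh j : H) g + ξ j ω)) 2 P :=
      MemLp.const_mul (f := fun ω => inner ℝ (eh j : H) g + ξ j ω) (MemLp.add (μ := P)
        (memLp_const (inner ℝ (eh j : H) g)) (memLp_two_of_hasLaw_gaussianReal (hξ j))) (Q j)
    exact (ContinuousLinearMap.toSpanSingleton ℝ (eh j : H)).comp_memLp' h1
  · have hn : ∀ ω, ‖numericalSolution β k Lh eh φ ξ g ω‖ ^ 2 =
        ∑ j : Fin N, Q j ^ 2 * (inner ℝ (eh j : H) g + ξ j ω) ^ 2 := fun ω => by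
      rw [hfun, ← Submodule.coe_norm, ← real_inner_self_eq_norm_sq, eh.orthonormal.inner_sum]
      refine Finset.sum_congr rfl fun j _ => ?_
      simp only [conj_trivial]
      ring
    simp_rw [hn]
    rw [integral_finsetSum Finset.univ
      (f := fun (j : Fin N) ω => Q j ^ 2 * (inner ℝ (eh j : H) g + ξ j ω) ^ 2)
      fun j _ => (integrable_add_sq (hξ j) _).const_mul _]
    refine Finset.sum_congr rfl fun j _ => ?_
    rw [integral_const_mul, integral_add_sq (hξ j)]

end Discrete

/-! ### Deterministic comparison of the two spectral sums. -/

/-- Powers of a sequence growing like `(j + 1) ^ α`. -/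
theorem exists_rpow_le_mul_rpow {a : ℕ → ℝ} {α : ℝ} (hα : ∃ c C : ℝ, 0 < c ∧ 0 < C ∧
      ∀ j : ℕ, c * ((j : ℝ) + 1) ^ α ≤ a j ∧ a j ≤ C * ((j : ℝ) + 1) ^ α) (t : ℝ) :
    ∃ D : ℝ, 0 < D ∧ ∀ j, a j ^ t ≤ D * ((j : ℝ) + 1) ^ (α * t) := by
  obtain ⟨c, C, hc, hC, h⟩ := hα
  rcases le_total 0 t with ht | ht
  · refine ⟨C ^ t, by positivity, fun j => ?_⟩
    have h0 : 0 ≤ a j := le_trans (by positivity) (h j).1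
    rw [Real.rpow_mul (by positivity), ← Real.mul_rpow hC.le (by positivity)]
    exact Real.rpow_le_rpow h0 (h j).2 ht
  · refine ⟨c ^ t, by positivity, fun j => ?_⟩
    rw [Real.rpow_mul (by positivity), ← Real.mul_rpow hc.le (by positivity)]
    exact Real.rpow_le_rpow_of_nonpos (by positivity) (h j).1 ht

/-- The convex function `x^(-s)` lies above its tangent at `a`. -/
theorem rpow_neg_sub_rpow_neg_le {a b s : ℝ} (ha : 0 < a) (hb : 0 < b) (hs : 0 ≤ s) :
    a ^ (-s) - b ^ (-s) ≤ s * (b - a) * a ^ (-s - 1) := by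
  have h1 : Real.log (b / a) ≤ b / a - 1 := Real.log_le_sub_one_of_pos (by positivity)
  have h2 : 1 - s * (b / a - 1) ≤ (b / a) ^ (-s) := by
    rw [Real.rpow_def_of_pos (by positivity)]
    refine le_trans ?_ (Real.add_one_le_exp _)
    nlinarith
  rw [Real.div_rpow hb.le ha.le, le_div_iff₀ (by positivity)] at h2
  rw [Real.rpow_sub_one ha.ne']
  have e : s * (b / a - 1) * a ^ (-s) = s * (b - a) * (a ^ (-s) / a) := by field_simp
  linarith

/-- The power `x^p` is largest at an endpoint of `[1, c h^(-δ)]`, which one depending on the sign of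
`p`. -/
theorem rpow_mul_rpow_le {δ c h₀ m ρ p : ℝ} (hc : 0 < c)
    (hh₁ : h₀ < 1) (hm : m ≤ ρ) (hm' : m ≤ ρ - δ * p) :
    ∃ C : ℝ, 0 < C ∧ ∀ h : ℝ, 0 < h → h < h₀ → ∀ x : ℝ, 1 ≤ x → x ≤ c * h ^ (-δ) →
      h ^ ρ * x ^ p ≤ C * h ^ m := by
  rcases le_total p 0 with hp | hp
  · refine ⟨1, one_pos, fun h h0 h1 x hx _ => ?_⟩
    rw [one_mul]
    calc h ^ ρ * x ^ p ≤ h ^ ρ * 1 := by gcongr; exact Real.rpow_le_one_of_one_le_of_nonpos hx hp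
      _ ≤ _ := by rw [mul_one]; exact Real.rpow_le_rpow_of_exponent_ge h0 (h1.trans hh₁).le hm
  · refine ⟨c ^ p, by positivity, fun h h0 h1 x hx hx' => ?_⟩
    calc h ^ ρ * x ^ p ≤ h ^ ρ * (c * h ^ (-δ)) ^ p := by gcongr
      _ = c ^ p * h ^ (ρ - δ * p) := by
          rw [Real.mul_rpow hc.le (by positivity), ← Real.rpow_mul h0.le, sub_eq_add_neg,
            Real.rpow_add h0]
          ring_nf
      _ ≤ _ := by
          gcongr _ * ?_
          exact Real.rpow_le_rpow_of_exponent_ge h0 (h1.trans hh₁).le hm'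

/-- Comparison of the second moments of a full and a truncated, perturbed random series. -/
theorem abs_spectral_sub_le {N : ℕ} {a G : ℕ → ℝ} {b Q G' D : Fin N → ℝ} {β I γ e A X : ℝ}
    (ha : ∀ j, 0 < a j) (hβ : 0 < β) (hI : HasSum (fun j => a j ^ (-(2 * β)) * (G j ^ 2 + 1)) I)
    (hsum : Summable fun j => a j ^ (-(2 * β))) (hγ : 0 ≤ γ) (hG : HasSum (fun j => G j ^ 2) (γ ^ 2))
    (hG' : ∑ j, G' j ^ 2 ≤ γ ^ 2) (hab : ∀ j : Fin N, a j ≤ b j)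
    (hX0 : 0 ≤ X) (hX : ∀ j : Fin N, a j ^ (-(2 * β)) - b j ^ (-(2 * β)) ≤ X)
    (hD : ∀ j : Fin N, |G j - G' j| ≤ D j * γ) (hA : ∀ j, a j ^ (-β) ≤ A)
    (hQ : ∀ j : Fin N, |b j ^ (-β) - Q j| ≤ e) (he : 0 ≤ e) :
    |I - ∑ j, Q j ^ 2 * (G' j ^ 2 + 1)| ≤
      (γ ^ 2 + 1) * ∑' j, a (j + N) ^ (-(2 * β)) +
      ∑ j : Fin N, (a j ^ (-(2 * β)) - b j ^ (-(2 * β))) + X * γ ^ 2 +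
      2 * γ ^ 2 * √(∑ j : Fin N, (a j ^ (-(2 * β)) * D j) ^ 2) +
      (2 * A * e + e ^ 2) * γ ^ 2 + (N * e ^ 2 + 2 * e * ∑ j : Fin N, a j ^ (-β)) := by
  have hb : ∀ j : Fin N, 0 < b j := fun j => (ha j).trans_le (hab j)
  have hba : ∀ (j : Fin N) (s : ℝ), 0 ≤ s → b j ^ (-s) ≤ a j ^ (-s) := fun j s hs =>
    Real.rpow_le_rpow_of_nonpos (ha j) (hab j) (by linarith)
  have ha2 : ∀ j, 0 ≤ a j ^ (-(2 * β)) := fun j => Real.rpow_nonneg (ha j).le _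
  have hGN : ∑ j : Fin N, G j ^ 2 ≤ γ ^ 2 := by
    rw [Fin.sum_univ_eq_sum_range (fun j => G j ^ 2)]
    exact sum_le_hasSum _ (fun _ _ => sq_nonneg _) hG
  -- In order: tail, eigenvalue error in the noise and in `g`, eigenvector error in `g`, quadrature
  -- error in `g` and in the noise.
  have hsplit : I - ∑ j, Q j ^ 2 * (G' j ^ 2 + 1) =
      ∑' j, a (j + N) ^ (-(2 * β)) * (G (j + N) ^ 2 + 1) +
      ∑ j : Fin N, (a j ^ (-(2 * β)) - b j ^ (-(2 * β))) +
      ∑ j : Fin N, (a j ^ (-(2 * β)) - b j ^ (-(2 * β))) * G j ^ 2 +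
      ∑ j : Fin N, b j ^ (-(2 * β)) * (G j ^ 2 - G' j ^ 2) +
      ∑ j : Fin N, (b j ^ (-(2 * β)) - Q j ^ 2) * G' j ^ 2 +
      ∑ j : Fin N, (b j ^ (-(2 * β)) - Q j ^ 2) := by
    have h := hI.summable.sum_add_tsum_nat_add N
    rw [hI.tsum_eq, ← Fin.sum_univ_eq_sum_range (fun j => a j ^ (-(2 * β)) * (G j ^ 2 + 1))] at h
    rw [← h, add_comm (∑ j : Fin N, _), add_sub_assoc, ← Finset.sum_sub_distrib]
    simp only [add_assoc]
    rw [← Finset.sum_add_distrib, ← Finset.sum_add_distrib, ← Finset.sum_add_distrib,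
      ← Finset.sum_add_distrib]
    congr 1
    exact Finset.sum_congr rfl fun j _ => by ring
  have t1 : |∑' j, a (j + N) ^ (-(2 * β)) * (G (j + N) ^ 2 + 1)| ≤
      (γ ^ 2 + 1) * ∑' j, a (j + N) ^ (-(2 * β)) := by
    rw [abs_of_nonneg (tsum_nonneg fun j => mul_nonneg (ha2 _) (by positivity)), ← tsum_mul_left]
    refine ((summable_nat_add_iff N).2 hI.summable).tsum_le_tsum (fun j => ?_)
      (((summable_nat_add_iff N).2 hsum).mul_left _)
    have := le_hasSum hG (j + N) fun i _ => sq_nonneg _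
    rw [mul_comm]
    exact mul_le_mul_of_nonneg_right (by linarith) (ha2 _)
  have hx0 : ∀ j : Fin N, 0 ≤ a j ^ (-(2 * β)) - b j ^ (-(2 * β)) := fun j =>
    sub_nonneg.2 (hba j (2 * β) (by positivity))
  have t2 : |∑ j : Fin N, (a j ^ (-(2 * β)) - b j ^ (-(2 * β)))| ≤
      ∑ j : Fin N, (a j ^ (-(2 * β)) - b j ^ (-(2 * β))) :=
    (abs_of_nonneg (Finset.sum_nonneg fun j _ => hx0 j)).le
  have t3 : |∑ j : Fin N, (a j ^ (-(2 * β)) - b j ^ (-(2 * β))) * G j ^ 2| ≤ X * γ ^ 2 := by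
    rw [abs_of_nonneg (Finset.sum_nonneg fun j _ => mul_nonneg (hx0 j) (sq_nonneg _))]
    calc _ ≤ ∑ j : Fin N, X * G j ^ 2 :=
          Finset.sum_le_sum fun j _ => mul_le_mul_of_nonneg_right (hX j) (sq_nonneg _)
      _ = X * ∑ j : Fin N, G j ^ 2 := (Finset.mul_sum _ _ _).symm
      _ ≤ _ := mul_le_mul_of_nonneg_left hGN hX0
  -- Factor the difference of squares, then apply Cauchy–Schwarz against `G` and `G'`. Only the
  -- square sum of the weighted eigenvector errors `D j` remains.
  have t4 : |∑ j : Fin N, b j ^ (-(2 * β)) * (G j ^ 2 - G' j ^ 2)| ≤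
      2 * γ ^ 2 * √(∑ j : Fin N, (a j ^ (-(2 * β)) * D j) ^ 2) := by
    set R := √(∑ j : Fin N, (a j ^ (-(2 * β)) * D j) ^ 2)
    have c1 := Real.sum_mul_le_sqrt_mul_sqrt Finset.univ
      (fun j : Fin N => a j ^ (-(2 * β)) * D j) (fun j => |G j|)
    have c2 := Real.sum_mul_le_sqrt_mul_sqrt Finset.univ
      (fun j : Fin N => a j ^ (-(2 * β)) * D j) (fun j => |G' j|)
    simp only [sq_abs] at c1 c2
    have s1 : √(∑ j : Fin N, G j ^ 2) ≤ γ := Real.sqrt_le_iff.2 ⟨hγ, hGN⟩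
    have s2 : √(∑ j : Fin N, G' j ^ 2) ≤ γ := Real.sqrt_le_iff.2 ⟨hγ, hG'⟩
    calc _ ≤ ∑ j : Fin N, |b j ^ (-(2 * β)) * (G j ^ 2 - G' j ^ 2)| := Finset.abs_sum_le_sum_abs _ _
      _ ≤ ∑ j : Fin N, γ * (a j ^ (-(2 * β)) * D j * |G j| + a j ^ (-(2 * β)) * D j * |G' j|) := by
          refine Finset.sum_le_sum fun j _ => ?_
          rw [sq_sub_sq, abs_mul, abs_mul, abs_of_pos (Real.rpow_pos_of_pos (hb j) _)]
          calc _ ≤ a j ^ (-(2 * β)) * ((|G j| + |G' j|) * (D j * γ)) :=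
                mul_le_mul (hba j _ (by positivity)) (mul_le_mul (abs_add_le _ _) (hD j)
                  (abs_nonneg _) (by positivity)) (by positivity) (ha2 _)
            _ = _ := by ring
      _ = γ * (∑ j : Fin N, a j ^ (-(2 * β)) * D j * |G j| +
            ∑ j : Fin N, a j ^ (-(2 * β)) * D j * |G' j|) := by
          rw [← Finset.mul_sum, Finset.sum_add_distrib]
      _ ≤ γ * (R * γ + R * γ) := by
          gcongr
          · exact c1.trans (by gcongr)
          · exact c2.trans (by gcongr)
      _ = _ := by ring
  have hq : ∀ j : Fin N, |b j ^ (-(2 * β)) - Q j ^ 2| ≤ 2 * a j ^ (-β) * e + e ^ 2 := fun j => by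
    have e1 : b j ^ (-(2 * β)) = (b j ^ (-β)) ^ 2 := by
      rw [← Real.rpow_natCast (_ ^ (-β)), ← Real.rpow_mul (hb j).le]
      congr 1; push_cast; ring
    have h1 : |b j ^ (-β) + Q j| ≤ 2 * a j ^ (-β) + e := by
      have h2 := hba j β hβ.le
      have h3 := abs_le.1 (hQ j)
      have h4 := Real.rpow_pos_of_pos (hb j) (-β)
      rw [abs_le]
      constructor <;> linarith [h3.1, h3.2]
    rw [e1, sq_sub_sq, abs_mul]
    calc _ ≤ (2 * a j ^ (-β) + e) * e :=
          mul_le_mul h1 (hQ j) (abs_nonneg _) ((abs_nonneg _).trans h1)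
      _ = _ := by ring
  have t5 : |∑ j : Fin N, (b j ^ (-(2 * β)) - Q j ^ 2) * G' j ^ 2| ≤
      (2 * A * e + e ^ 2) * γ ^ 2 := by
    have hA0 : 0 ≤ A := (Real.rpow_nonneg (ha 0).le _).trans (hA 0)
    calc _ ≤ ∑ j : Fin N, |(b j ^ (-(2 * β)) - Q j ^ 2) * G' j ^ 2| := Finset.abs_sum_le_sum_abs _ _
      _ ≤ ∑ j : Fin N, (2 * A * e + e ^ 2) * G' j ^ 2 := by
          refine Finset.sum_le_sum fun j _ => ?_
          rw [abs_mul, abs_of_nonneg (sq_nonneg (G' j))]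
          gcongr
          refine (hq j).trans ?_
          gcongr
          exact hA j
      _ = (2 * A * e + e ^ 2) * ∑ j : Fin N, G' j ^ 2 := (Finset.mul_sum _ _ _).symm
      _ ≤ _ := by gcongr
  have t6 : |∑ j : Fin N, (b j ^ (-(2 * β)) - Q j ^ 2)| ≤
      N * e ^ 2 + 2 * e * ∑ j : Fin N, a j ^ (-β) := by
    refine (Finset.abs_sum_le_sum_abs _ _).trans ((Finset.sum_le_sum fun j _ => hq j).trans ?_)
    rw [Finset.sum_add_distrib, Finset.mul_sum]
    simp only [Finset.sum_const, Finset.card_univ, Fintype.card_fin, nsmul_eq_mul]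
    rw [add_comm, add_le_add_iff_left]
    exact (Finset.sum_congr rfl fun j _ => by ring).le
  rw [hsplit]
  refine (abs_add_le _ _).trans (add_le_add ?_ t6)
  refine (abs_add_le _ _).trans (add_le_add ?_ t5)
  refine (abs_add_le _ _).trans (add_le_add ?_ t4)
  refine (abs_add_le _ _).trans (add_le_add ?_ t3)
  exact (abs_add_le _ _).trans (add_le_add t1 t2)

/-! ### Convergence rates in `h` from the eigenvalue growth. -/

section Rates

variable {a : ℕ → ℝ} {α β δ c₁ c₂ h₀ : ℝ}

theorem summable_rpow_of_growth (ha : ∀ j, 0 < a j) (hα : ∃ c C : ℝ, 0 < c ∧ 0 < C ∧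
      ∀ j : ℕ, c * ((j : ℝ) + 1) ^ α ≤ a j ∧ a j ≤ C * ((j : ℝ) + 1) ^ α) (hαβ : 1 < 2 * α * β) :
    Summable fun j => a j ^ (-(2 * β)) := by
  obtain ⟨D, hD, h⟩ := exists_rpow_le_mul_rpow hα (-(2 * β))
  have hs : Summable fun j : ℕ => ((j : ℝ) + 1) ^ (α * -(2 * β)) := by
    have := (summable_nat_add_iff 1).2 (Real.summable_nat_rpow.2
      (by linarith : α * -(2 * β) < -1))
    simpa using this
  exact .of_nonneg_of_le (fun j => Real.rpow_nonneg (ha j).le _) h (hs.mul_left D)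

theorem exists_tail_le (ha : ∀ j, 0 < a j) (hα : ∃ c C : ℝ, 0 < c ∧ 0 < C ∧
      ∀ j : ℕ, c * ((j : ℝ) + 1) ^ α ≤ a j ∧ a j ≤ C * ((j : ℝ) + 1) ^ α) (hαβ : 1 < 2 * α * β)
    (hc₁ : 0 < c₁) :
    ∃ K : ℝ, 0 < K ∧ ∀ h : ℝ, 0 < h → ∀ N : ℕ, c₁ * h ^ (-δ) ≤ N →
      ∑' j, a (j + N) ^ (-(2 * β)) ≤ K * h ^ (δ * (2 * α * β - 1)) := by
  obtain ⟨D, hD, hle⟩ := exists_rpow_le_mul_rpow hα (-(2 * β))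
  have hp : 0 < 2 * α * β - 1 := by linarith
  refine ⟨D * ((2 * α * β - 1)⁻¹ * c₁ ^ (1 - 2 * α * β)), by positivity, fun h h0 N hN => ?_⟩
  have hh : 0 < c₁ * h ^ (-δ) := by positivity
  have hN0 : 0 < N := by exact_mod_cast hh.trans_le hN
  have hsum := summable_rpow_of_growth ha hα hαβ
  have hs : Summable fun j : ℕ => (((j + N : ℕ) : ℝ) + 1) ^ (-(2 * α * β)) := by
    have := (summable_nat_add_iff (N + 1)).2 (Real.summable_nat_rpow.2
      (by linarith : -(2 * α * β) < -1))
    refine this.congr fun j => ?_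
    push_cast
    ring_nf
  calc ∑' j, a (j + N) ^ (-(2 * β))
      ≤ ∑' j : ℕ, D * (((j + N : ℕ) : ℝ) + 1) ^ (-(2 * α * β)) := by
        refine ((summable_nat_add_iff N).2 hsum).tsum_le_tsum (fun j => ?_) (hs.mul_left D)
        refine (hle (j + N)).trans (le_of_eq ?_)
        ring_nf
    _ = D * ∑' j : ℕ, (((j + N : ℕ) : ℝ) + 1) ^ (-(2 * α * β)) := tsum_mul_left
    _ ≤ D * ((2 * α * β - 1)⁻¹ * (c₁ * h ^ (-δ)) ^ (1 - 2 * α * β)) := by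
        gcongr
        refine (tsum_rpow_tail_le hαβ hN0).trans ?_
        gcongr _ * ?_
        exact Real.rpow_le_rpow_of_nonpos hh hN (by linarith)
    _ = _ := by
        rw [Real.mul_rpow hc₁.le (by positivity), ← Real.rpow_mul h0.le]
        ring_nf

theorem rpow_neg_sub_rpow_neg_le_of_eig_err {x b C₁ h r q : ℝ} (hβ : 0 < β) (hx : 0 < x)
    (hb : x ≤ b) (hb' : b ≤ x + C₁ * h ^ r * x ^ q) :
    x ^ (-(2 * β)) - b ^ (-(2 * β)) ≤ 2 * β * C₁ * (h ^ r * x ^ (q - 2 * β - 1)) := by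
  refine (rpow_neg_sub_rpow_neg_le hx (hx.trans_le hb) (by positivity)).trans ?_
  calc _ ≤ 2 * β * (C₁ * h ^ r * x ^ q) * x ^ (-(2 * β) - 1) := by gcongr; linarith
    _ = _ := by
      rw [show q - 2 * β - 1 = q + (-(2 * β) - 1) by ring, Real.rpow_add hx]
      ring

/-- Weighted sums of eigenvalue powers over at most `c₂ h ^ (-δ)` indices. -/
theorem exists_rpow_mul_sum_growth_le
    (hα : ∃ c C : ℝ, 0 < c ∧ 0 < C ∧
      ∀ j : ℕ, c * ((j : ℝ) + 1) ^ α ≤ a j ∧ a j ≤ C * ((j : ℝ) + 1) ^ α)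
    (t : ℝ) {m ρ : ℝ} (hδ : 0 < δ) (hc₂ : 0 < c₂) (hh₀ : 0 < h₀)
    (hh₁ : h₀ < 1) (hm : m ≤ ρ) (hm' : m ≤ ρ - δ * (1 + α * t)) {χ : ℝ → ℝ}
    (hχ : ∀ h, 0 < h → h < h₀ → χ h = 1 ∨ χ h = |Real.log h|)
    (hcrit : α * t = -1 → m = ρ → ∀ h, 0 < h → h < h₀ → χ h = |Real.log h|) :
    ∃ C : ℝ, 0 < C ∧ ∀ h : ℝ, 0 < h → h < h₀ → ∀ N : ℕ, (N : ℝ) ≤ c₂ * h ^ (-δ) →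
      h ^ ρ * ∑ j : Fin N, a j ^ t ≤ C * (h ^ m * χ h) := by
  obtain ⟨D, hD, hle⟩ := exists_rpow_le_mul_rpow hα t
  obtain ⟨K, hK, hsum⟩ := rpow_mul_sum_rpow_le hδ hc₂ hh₀ hh₁ hm hm' hχ hcrit
  refine ⟨D * K, by positivity, fun h h0 h1 N hN => ?_⟩
  rw [Fin.sum_univ_eq_sum_range (fun j => a j ^ t)]
  calc _ ≤ h ^ ρ * ∑ j ∈ Finset.range N, D * ((j : ℝ) + 1) ^ (α * t) := by
        gcongr with j
        exact hle j
    _ = D * (h ^ ρ * ∑ j ∈ Finset.range N, ((j : ℝ) + 1) ^ (α * t)) := by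
        rw [← Finset.mul_sum]; ring
    _ ≤ D * (K * (h ^ m * χ h)) := mul_le_mul_of_nonneg_left (hsum h h0 h1 N hN) hD.le
    _ = _ := by ring

theorem exists_rpow_mul_growth_le
    (hα : ∃ c C : ℝ, 0 < c ∧ 0 < C ∧
      ∀ j : ℕ, c * ((j : ℝ) + 1) ^ α ≤ a j ∧ a j ≤ C * ((j : ℝ) + 1) ^ α)
    (t : ℝ) {m ρ : ℝ} (hc₂ : 0 < c₂)
    (hh₁ : h₀ < 1) (hm : m ≤ ρ) (hm' : m ≤ ρ - δ * (α * t)) :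
    ∃ C : ℝ, 0 < C ∧ ∀ h : ℝ, 0 < h → h < h₀ → ∀ N : ℕ, (N : ℝ) ≤ c₂ * h ^ (-δ) →
      ∀ j : Fin N, h ^ ρ * a j ^ t ≤ C * h ^ m := by
  obtain ⟨D, hD, hle⟩ := exists_rpow_le_mul_rpow hα t
  obtain ⟨K, hK, hb⟩ := rpow_mul_rpow_le (δ := δ) (p := α * t) hc₂ hh₁ hm hm'
  refine ⟨D * K, by positivity, fun h h0 h1 N hN j => ?_⟩
  have hj : ((j : ℕ) : ℝ) + 1 ≤ N := by exact_mod_cast j.2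
  calc _ ≤ h ^ ρ * (D * (((j : ℕ) : ℝ) + 1) ^ (α * t)) := by gcongr; exact hle j
    _ = D * (h ^ ρ * (((j : ℕ) : ℝ) + 1) ^ (α * t)) := by ring
    _ ≤ D * (K * h ^ m) := mul_le_mul_of_nonneg_left (hb h h0 h1 _
        (by linarith [(j : ℕ).cast_nonneg (α := ℝ)]) (hj.trans hN)) hD.le
    _ = _ := by ring

/-- The sum `∑ λ_j ^ (-β)` over the discrete spectrum. -/
theorem exists_sum_rpow_neg_le
    (hα : ∃ c C : ℝ, 0 < c ∧ 0 < C ∧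
      ∀ j : ℕ, c * ((j : ℝ) + 1) ^ α ≤ a j ∧ a j ≤ C * ((j : ℝ) + 1) ^ α)
    {d : ℕ} (hd : 0 < d) (hc₂ : 0 < c₂) (hh₀ : 0 < h₀) (hh₁ : h₀ < 1) :
    ∃ C : ℝ, 0 < C ∧ ∀ h : ℝ, 0 < h → h < h₀ → ∀ N : ℕ, (N : ℝ) ≤ c₂ * h ^ (-(d : ℝ)) →
      ∑ j : Fin N, a j ^ (-β) ≤ C * (1 + weakRateFactor d α β h) := by
  have hd' : (0 : ℝ) < d := by exact_mod_cast hd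
  by_cases h1 : α * β = 1
  · obtain ⟨C, hC, hle⟩ := exists_rpow_mul_sum_growth_le hα (-β) (m := 0) (ρ := 0)
      (χ := fun h => |Real.log h|) hd' hc₂ hh₀ hh₁ le_rfl (by rw [mul_neg, h1]; simp)
      (fun _ _ _ => Or.inr rfl) (fun _ _ _ _ _ => rfl)
    refine ⟨C, hC, fun h h0 hlt N hN => ?_⟩
    have := hle h h0 hlt N hN
    rw [Real.rpow_zero, one_mul, one_mul] at this
    rw [weakRateFactor, if_pos h1]
    exact this.trans (by gcongr; linarith)
  -- The exponent `min 0 (d (αβ - 1))` covers both convergent (`αβ > 1`) and divergent sums; the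
  -- summand `1` in the bound serves the convergent case.
  · obtain ⟨C, hC, hle⟩ := exists_rpow_mul_sum_growth_le hα (-β) (ρ := 0)
      (m := min 0 (d * (α * β - 1))) (χ := fun _ => 1) hd' hc₂ hh₀ hh₁ (min_le_left _ _)
      ((min_le_right _ _).trans (by linarith))
      (fun _ _ _ => Or.inl rfl) (fun h => absurd (by linarith) h1)
    refine ⟨C, hC, fun h h0 hlt N hN => ?_⟩
    have := hle h h0 hlt N hN
    rw [Real.rpow_zero, one_mul, mul_one] at this
    rw [weakRateFactor, if_neg h1]
    refine this.trans ?_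
    gcongr
    rcases min_choice (0 : ℝ) (d * (α * β - 1)) with e | e <;> rw [e]
    · rw [Real.rpow_zero]
      linarith [Real.rpow_nonneg h0.le (d * (α * β - 1))]
    · linarith

end Rates

end

/-! ### Assembly of the weak-type error estimate. -/

theorem mainTheorem2
    {H : Type*} [NormedAddCommGroup H] [InnerProductSpace ℝ H] [CompleteSpace H]
    {L : H →ₗ.[ℝ] H} (hL : IsEllipticOperator L) (S : OrderedEigenbasis L)
    {α β : ℝ} (hβ : 0 < β) (hβ1 : β < 1)
    (hα : ∃ c C : ℝ, 0 < c ∧ 0 < C ∧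
      ∀ j : ℕ, c * ((j : ℝ) + 1) ^ α ≤ S.eig j ∧ S.eig j ≤ C * ((j : ℝ) + 1) ^ α)
    -- Gaussian white noise
    {Ω : Type*} [MeasurableSpace Ω] {P : Measure Ω} [IsProbabilityMeasure P]
    {ξ : ℕ → Ω → ℝ} (hξ_indep : iIndepFun ξ P) (hξ_law : ∀ j, HasLaw (ξ j) (gaussianReal 0 1) P)
    {W : Ω → S.HDotDual β} (hW : S.IsWhiteNoise P β hβ.le ξ W)
    -- the finite element spaces, with the eigenpairs of the Galerkin operators
    {V : Set.Ioo (0 : ℝ) 1 → Submodule ℝ H} [∀ h, FiniteDimensional ℝ (V h)]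
    (hV : ∀ h, V h ≤ S.powDomain (1 / 2))
    (eh : ∀ h, OrthonormalBasis (Fin (Module.finrank ℝ (V h))) ℝ (V h))
    (eigh : ∀ h, Fin (Module.finrank ℝ (V h)) → ℝ)
    (heigh_mono : ∀ h, Monotone (eigh h))
    (heigh : ∀ h j, S.galerkin (V h) (hV h) (eh h j) = eigh h j • eh h j)
    -- the assumptions on the finite element spaces
    {d : ℕ} (hd : 0 < d)
    (hdim : ∃ c C : ℝ, 0 < c ∧ 0 < C ∧ ∀ h : Set.Ioo (0 : ℝ) 1,
      c * (h : ℝ) ^ (-(d : ℝ)) ≤ Module.finrank ℝ (V h) ∧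
      Module.finrank ℝ (V h) ≤ C * (h : ℝ) ^ (-(d : ℝ)))
    {C₁ C₂ h₀ r s q : ℝ} (hC₁ : 0 < C₁) (hC₂ : 0 < C₂) (hh₀ : 0 < h₀) (hh₀1 : h₀ < 1)
    (hr : 0 < r) (hs : 0 < s) (hq : 1 < q)
    (heig_err : ∀ h : Set.Ioo (0 : ℝ) 1, (h : ℝ) < h₀ → ∀ j : Fin (Module.finrank ℝ (V h)),
      S.eig j ≤ eigh h j ∧ eigh h j ≤ S.eig j + C₁ * (h : ℝ) ^ r * S.eig j ^ q)
    (hvec_err : ∀ h : Set.Ioo (0 : ℝ) 1, (h : ℝ) < h₀ → ∀ j : Fin (Module.finrank ℝ (V h)),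
      ‖S.basis j - (eh h j : H)‖ ^ 2 ≤ C₂ * (h : ℝ) ^ (2 * s) * S.eig j ^ q)
    (hα_lower : 1 / (2 * β) < α)
    (hα_upper : α ≤ min (r / ((q - 1) * d)) (2 * s / (q * d)))
    {k₀ : ℝ} (hk₀ : 0 < k₀) :
    ∃ C : ℝ, 0 < C ∧
      ∀ (h : Set.Ioo (0 : ℝ) 1), (h : ℝ) < h₀ → ∀ k : ℝ, 0 < k → k < k₀ →
      ∀ (φ : Module.Basis (Fin (Module.finrank ℝ (V h))) ℝ (V h)) (g : H) (u : Ω → H),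
        S.IsSolution P β hβ.le g W u →
        let uQ : Ω → H :=
          numericalSolution β k (S.galerkin (V h) (hV h)) (eh h) φ ξ g
        MemLp u 2 P ∧ MemLp uQ 2 P ∧
        |(∫ ω, ‖u ω‖ ^ 2 ∂P) - ∫ ω, ‖uQ ω‖ ^ 2 ∂P| ≤
          C * ((h : ℝ) ^ min (d * (2 * α * β - 1)) (min r s) + Real.exp (-Real.pi ^ 2 / (2 * k)))
              * ‖g‖ ^ 2
          + C * ((h : ℝ) ^ min (d * (2 * α * β - 1)) r * criticalFactor d α β q r h
              + Real.exp (-Real.pi ^ 2 / k) * (h : ℝ) ^ (-(d : ℝ))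
              + Real.exp (-Real.pi ^ 2 / (2 * k))
              + Real.exp (-Real.pi ^ 2 / (2 * k)) * weakRateFactor d α β h) := by
  obtain ⟨c₁, c₂, hc₁, hc₂, hN⟩ := hdim
  have hd' : (0 : ℝ) < d := by exact_mod_cast hd
  have hαβ : 1 < 2 * α * β := by
    rw [div_lt_iff₀ (by positivity)] at hα_lower
    linarith
  have hαr : α * d * (q - 1) ≤ r := by
    have h1 := hα_upper.trans (min_le_left _ _)
    rw [le_div_iff₀ (mul_pos (by linarith) hd')] at h1
    linarith
  have hαs : α * d * q ≤ 2 * s := by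
    have h1 := hα_upper.trans (min_le_right _ _)
    rw [le_div_iff₀ (mul_pos (by linarith) hd')] at h1
    linarith
  set μ : ℝ := d * (2 * α * β - 1) with hμ
  have hμ0 : 0 < μ := mul_pos hd' (by linarith)
  set χ : ℝ → ℝ := criticalFactor d α β q r with hχ_def
  have hχ : ∀ h, 0 < h → h < h₀ → χ h = 1 ∨ χ h = |Real.log h| := fun h _ _ => by
    simp only [hχ_def, criticalFactor]
    split_ifs
    · exact Or.inr rfl
    · exact Or.inl rfl
  obtain ⟨b, hb, hbχ⟩ := exists_one_le_mul_of_one_or_log hh₀ hh₀1 hχ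
  obtain ⟨K₁, hK₁, hT₁⟩ := exists_tail_le (δ := (d : ℝ)) S.eig_pos hα hαβ hc₁
  -- By `hαr` the exponent `r - d (1 + α (q - 2β - 1))` is at least `μ`. The borderline sum has `α d
  -- (q - 1) = μ`; combined with `r ≤ μ` and `hαr` this forces `α d (q - 1) = μ = r`, exactly the
  -- critical case.
  obtain ⟨K₂, hK₂, hT₂⟩ := exists_rpow_mul_sum_growth_le hα (q - 2 * β - 1) (ρ := r)
    (m := min μ r) (χ := χ) hd' hc₂ hh₀ hh₀1 (min_le_right _ _)
    ((min_le_left _ _).trans (by rw [hμ]; nlinarith))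
    (fun h h0 h1 => hχ h h0 h1) (fun hp hm h _ _ => by
      have h1 : r ≤ μ := by rw [← hm]; exact min_le_left _ _
      have h2 : α * (q - 1) = 2 * α * β - 1 := by linarith
      have h3 : α * d * (q - 1) = μ := by rw [hμ, ← h2]; ring
      simp only [hχ_def, criticalFactor]
      exact if_pos ⟨by linarith, by linarith⟩)
  obtain ⟨K₃, hK₃, hT₃⟩ := exists_rpow_mul_growth_le (δ := (d : ℝ)) hα (q - 2 * β - 1) (ρ := r)
    (m := min μ r) hc₂ hh₀1 (min_le_right _ _) ((min_le_left _ _).trans (by rw [hμ]; nlinarith))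
  -- This sum enters under a square root, hence the doubled exponents. By `hαs`, `2s - d (1 + α (q -
  -- 4β)) ≥ 2μ + d`; the spare `d` excludes a logarithm.
  obtain ⟨K₄, hK₄, hT₄⟩ := exists_rpow_mul_sum_growth_le hα (q - 4 * β) (ρ := 2 * s)
    (m := 2 * min μ s) (χ := fun _ => 1) hd' hc₂ hh₀ hh₀1
    (by linarith [min_le_right μ s]) (by
      have := min_le_left μ s
      rw [hμ] at this
      nlinarith)
    (fun _ _ _ => Or.inl rfl) (fun hp hm => by
      have h1 := min_le_left μ s
      rw [hμ] at h1
      nlinarith)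
  obtain ⟨K₅, hK₅, hT₅⟩ := exists_sum_rpow_neg_le (β := β) hα hd hc₂ hh₀ hh₀1
  obtain ⟨K₆, hK₆, hT₆⟩ := exists_abs_rpow_sub_sincScalar_le hβ hβ1 (S.eig_pos 0) hk₀
  have hA : ∀ j, S.eig j ^ (-β) ≤ S.eig 0 ^ (-β) := fun j =>
    Real.rpow_le_rpow_of_nonpos (S.eig_pos 0) (S.eig_mono j.zero_le) (by linarith)
  set A := S.eig 0 ^ (-β)
  have hA0 : 0 < A := Real.rpow_pos_of_pos (S.eig_pos 0) _
  -- The first five summands collect the errors multiplying `‖g‖²`, the last four those of the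
  -- noise.
  refine ⟨K₁ + 2 * β * C₁ * K₃ + 2 * √(C₂ * K₄) + 2 * A * K₆ + K₆ ^ 2 + K₁ * b + 2 * β * C₁ * K₂ +
    c₂ * K₆ ^ 2 + 2 * K₆ * K₅, by positivity, ?_⟩
  intro h hh k hk hkk φ g u hu
  have h0 : 0 < (h : ℝ) := h.2.1
  have hle1 : (h : ℝ) ≤ 1 := h.2.2.le
  obtain ⟨hN₁, hN₂⟩ := hN h
  have hb0 : ∀ j : Fin (Module.finrank ℝ (V h)), S.eig j ≤ eigh h j := fun j => (heig_err h hh j).1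
  have hQ : ∀ j, sincQuadrature β k (S.galerkin (V h) (hV h)) (eh h j) =
      sincScalar β k (eigh h j) • eh h j := fun j =>
    S.sincQuadrature_galerkin_apply (V h) (hV h) β k ((S.eig_pos j).le.trans (hb0 j)) (heigh h j)
  have hsum := summable_rpow_of_growth S.eig_pos hα hαβ
  obtain ⟨hmu, hIu⟩ := hu.memLp_and_integral hW hξ_law hsum
  obtain ⟨hmq, hIq⟩ := memLp_and_integral_numericalSolution (eh h) hQ φ hξ_law g
  refine ⟨hmu, hmq, ?_⟩
  rw [hIq]
  set E := Real.exp (-Real.pi ^ 2 / (2 * k)) with hE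
  have hE0 : 0 < E := Real.exp_pos _
  have hE1 : E ≤ 1 := by
    rw [hE, Real.exp_le_one_iff, neg_div]
    exact neg_nonpos.2 (by positivity)
  have hEE : Real.exp (-Real.pi ^ 2 / k) = E ^ 2 := by
    rw [hE, ← Real.exp_nat_mul]
    congr 1
    field_simp
    norm_num
  have hbessel : ∑ j, inner ℝ (eh h j : H) g ^ 2 ≤ ‖g‖ ^ 2 := by
    have := ((eh h).orthonormal.comp_linearIsometry (V h).subtypeₗᵢ).sum_inner_products_le
      (x := g) (s := Finset.univ)
    simpa using this
  have hdiff : ∀ j : Fin (Module.finrank ℝ (V h)), |inner ℝ (S.basis j) g - inner ℝ (eh h j : H) g| ≤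
      ‖S.basis j - (eh h j : H)‖ * ‖g‖ := fun j => by
    rw [← inner_sub_left]
    exact abs_real_inner_le_norm _ _
  have hx : ∀ j : Fin (Module.finrank ℝ (V h)),
      S.eig j ^ (-(2 * β)) - eigh h j ^ (-(2 * β)) ≤
        2 * β * C₁ * ((h : ℝ) ^ r * S.eig j ^ (q - 2 * β - 1)) := fun j =>
    rpow_neg_sub_rpow_neg_le_of_eig_err hβ (S.eig_pos j) (hb0 j) (heig_err h hh j).2
  have key := abs_spectral_sub_le (X := 2 * β * C₁ * (K₃ * (h : ℝ) ^ min μ r)) (e := K₆ * E)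
    S.eig_pos hβ hIu hsum (norm_nonneg g) (OrderedEigenbasis.hasSum_sq_inner g) hbessel hb0
    (by positivity)
    (fun j => (hx j).trans (mul_le_mul_of_nonneg_left (hT₃ h h0 hh _ hN₂ j) (by positivity)))
    hdiff hA
    (fun j => hT₆ k hk hkk _ ((S.eig_mono (Nat.zero_le _)).trans (hb0 j))) (by positivity)
  refine key.trans ?_
  set M := (h : ℝ) ^ min μ (min r s) with hM
  set m := (h : ℝ) ^ min μ r with hm
  set F := weakRateFactor d α β h with hF
  have hF0 : 0 ≤ F := by
    simp only [hF, weakRateFactor]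
    split_ifs
    · exact abs_nonneg _
    · positivity
  have hm0 : 0 < m := Real.rpow_pos_of_pos h0 _
  have hM0 : 0 < M := Real.rpow_pos_of_pos h0 _
  have hχ0 : 0 ≤ χ h := by
    rcases hχ h h0 hh with e | e <;> rw [e]
    · exact zero_le_one
    · exact abs_nonneg _
  have hμm : (h : ℝ) ^ μ ≤ m := Real.rpow_le_rpow_of_exponent_ge h0 hle1 (min_le_left _ _)
  have hmM : m ≤ M := Real.rpow_le_rpow_of_exponent_ge h0 hle1
    (min_le_min_left _ (min_le_left _ _))
  have hsM : (h : ℝ) ^ min μ s ≤ M := Real.rpow_le_rpow_of_exponent_ge h0 hle1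
    (min_le_min_left _ (min_le_right _ _))
  -- The noise part of the tail carries no logarithm and is absorbed into the term with `χ`.
  have hmχ : m ≤ b * (m * χ h) := by
    have := mul_le_mul_of_nonneg_left (hbχ h h0 hh) hm0.le
    linarith
  have b₁ : (‖g‖ ^ 2 + 1) * ∑' j, S.eig (j + Module.finrank ℝ (V h)) ^ (-(2 * β)) ≤
      K₁ * (M * ‖g‖ ^ 2) + K₁ * b * (m * χ h) := by
    have h1 := hT₁ h h0 _ hN₁
    have h2 : K₁ * (h : ℝ) ^ μ ≤ K₁ * m := mul_le_mul_of_nonneg_left hμm hK₁.le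
    calc _ ≤ (‖g‖ ^ 2 + 1) * (K₁ * m) := mul_le_mul_of_nonneg_left (h1.trans h2) (by positivity)
      _ = K₁ * (m * ‖g‖ ^ 2) + K₁ * m := by ring
      _ ≤ K₁ * (M * ‖g‖ ^ 2) + K₁ * (b * (m * χ h)) := by gcongr
      _ = _ := by ring
  have b₂ : ∑ j : Fin (Module.finrank ℝ (V h)),
      (S.eig j ^ (-(2 * β)) - eigh h j ^ (-(2 * β))) ≤ 2 * β * C₁ * K₂ * (m * χ h) := by
    refine (Finset.sum_le_sum fun j _ => hx j).trans ?_
    rw [← Finset.mul_sum, ← Finset.mul_sum, mul_assoc _ K₂]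
    exact mul_le_mul_of_nonneg_left (hT₂ h h0 hh _ hN₂) (by positivity)
  have b₃ : 2 * β * C₁ * (K₃ * m) * ‖g‖ ^ 2 ≤ 2 * β * C₁ * K₃ * (M * ‖g‖ ^ 2) := by
    calc _ ≤ 2 * β * C₁ * (K₃ * M) * ‖g‖ ^ 2 := by gcongr
      _ = _ := by ring
  have b₄ : 2 * ‖g‖ ^ 2 * √(∑ j : Fin (Module.finrank ℝ (V h)),
      (S.eig j ^ (-(2 * β)) * ‖S.basis j - (eh h j : H)‖) ^ 2) ≤
      2 * √(C₂ * K₄) * (M * ‖g‖ ^ 2) := by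
    have h1 : ∑ j : Fin (Module.finrank ℝ (V h)),
        (S.eig j ^ (-(2 * β)) * ‖S.basis j - (eh h j : H)‖) ^ 2 ≤
        C₂ * K₄ * ((h : ℝ) ^ min μ s) ^ 2 := by
      calc _ ≤ ∑ j : Fin (Module.finrank ℝ (V h)),
            C₂ * ((h : ℝ) ^ (2 * s) * S.eig j ^ (q - 4 * β)) := by
            refine Finset.sum_le_sum fun j _ => ?_
            rw [mul_pow, show q - 4 * β = -(2 * β) + -(2 * β) + q by ring,
              Real.rpow_add (S.eig_pos j), Real.rpow_add (S.eig_pos j), ← sq]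
            refine (mul_le_mul_of_nonneg_left (hvec_err h hh j) (sq_nonneg _)).trans (le_of_eq ?_)
            ring
        _ = C₂ * ((h : ℝ) ^ (2 * s) * ∑ j : Fin (Module.finrank ℝ (V h)),
              S.eig j ^ (q - 4 * β)) := by rw [← Finset.mul_sum, ← Finset.mul_sum]
        _ ≤ C₂ * (K₄ * ((h : ℝ) ^ (2 * min μ s) * 1)) :=
            mul_le_mul_of_nonneg_left (hT₄ h h0 hh _ hN₂) hC₂.le
        _ = _ := by
            rw [mul_comm 2 (min μ s), Real.rpow_mul h0.le, Real.rpow_two]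
            ring
    have h2 := Real.sqrt_le_sqrt h1
    rw [Real.sqrt_mul (by positivity), Real.sqrt_sq (by positivity)] at h2
    calc _ ≤ 2 * ‖g‖ ^ 2 * (√(C₂ * K₄) * M) := by
          refine mul_le_mul_of_nonneg_left (h2.trans ?_) (by positivity)
          gcongr
      _ = _ := by ring
  have b₅ : (2 * A * (K₆ * E) + (K₆ * E) ^ 2) * ‖g‖ ^ 2 ≤
      (2 * A * K₆ + K₆ ^ 2) * (E * ‖g‖ ^ 2) := by
    have h1 : K₆ ^ 2 * (E * E) ≤ K₆ ^ 2 * (E * 1) := by gcongr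
    calc _ = (2 * A * K₆ * E + K₆ ^ 2 * (E * E)) * ‖g‖ ^ 2 := by ring
      _ ≤ (2 * A * K₆ * E + K₆ ^ 2 * (E * 1)) * ‖g‖ ^ 2 := by gcongr
      _ = _ := by ring
  have b₆ : (Module.finrank ℝ (V h) : ℝ) * (K₆ * E) ^ 2 +
      2 * (K₆ * E) * ∑ j : Fin (Module.finrank ℝ (V h)), S.eig j ^ (-β) ≤
      c₂ * K₆ ^ 2 * (E ^ 2 * (h : ℝ) ^ (-(d : ℝ))) + 2 * K₆ * K₅ * (E + E * F) := by
    have h1 := mul_le_mul_of_nonneg_right hN₂ (sq_nonneg (K₆ * E))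
    have h2 := mul_le_mul_of_nonneg_left (hT₅ h h0 hh _ hN₂) (by positivity : 0 ≤ 2 * (K₆ * E))
    calc _ ≤ c₂ * (h : ℝ) ^ (-(d : ℝ)) * (K₆ * E) ^ 2 + 2 * (K₆ * E) * (K₅ * (1 + F)) :=
          add_le_add h1 h2
      _ = _ := by ring
  rw [hEE]
  have p₁ := mul_pos (mul_pos two_pos hβ) hC₁
  have p₂ : 0 ≤ 2 * √(C₂ * K₄) := by positivity
  have p₃ : 0 < 2 * A * K₆ := by positivity
  have p₄ : 0 < K₆ ^ 2 := by positivity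
  have p₅ : 0 < K₁ * b := by positivity
  have p₆ : 0 < c₂ * K₆ ^ 2 := by positivity
  have p₇ : 0 < 2 * K₆ * K₅ := by positivity
  have p₈ := mul_pos p₁ hK₂
  have p₉ := mul_pos p₁ hK₃
  set Ct := K₁ + 2 * β * C₁ * K₃ + 2 * √(C₂ * K₄) + 2 * A * K₆ + K₆ ^ 2 + K₁ * b +
    2 * β * C₁ * K₂ + c₂ * K₆ ^ 2 + 2 * K₆ * K₅ with hCt
  have q₁ := mul_le_mul_of_nonneg_right
    (by linarith : K₁ + 2 * β * C₁ * K₃ + 2 * √(C₂ * K₄) ≤ Ct)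
    (by positivity : 0 ≤ M * ‖g‖ ^ 2)
  have q₂ := mul_le_mul_of_nonneg_right (by linarith : 2 * A * K₆ + K₆ ^ 2 ≤ Ct)
    (by positivity : 0 ≤ E * ‖g‖ ^ 2)
  have q₃ := mul_le_mul_of_nonneg_right (by linarith : K₁ * b + 2 * β * C₁ * K₂ ≤ Ct)
    (by positivity : 0 ≤ m * χ h)
  have q₄ := mul_le_mul_of_nonneg_right (by linarith : c₂ * K₆ ^ 2 ≤ Ct)
    (by positivity : 0 ≤ E ^ 2 * (h : ℝ) ^ (-(d : ℝ)))
  have q₅ := mul_le_mul_of_nonneg_right (by linarith : 2 * K₆ * K₅ ≤ Ct)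
    (by positivity : 0 ≤ E + E * F)
  linear_combination b₁ + b₂ + b₃ + b₄ + b₅ + b₆ + q₁ + q₂ + q₃ + q₄ + q₅
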